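/- Let $\lambda_1\in\mathbb{C}$ with $\operatorname{Re}\lambda_1>0$ and $\operatorname{Im}\lambda_1>0$, and let $u\in H^2(\mathbb{R})\cap H^{1,1}(\mathbb{R})$ be complex-valued, where $H^{1,1}(\mathbb{R})=\{u:\ \langle x\rangle u\in L^2(\mathbb{R}),\ \langle x\rangle\partial_xu\in L^2(\mathbb{R})\}$ and $\langle x\rangle=(1+x^2)^{1/2}$. Consider the Kaup--Newell spectral problem $$\partial_x\psi=\left[-i\lambda_1^2\begin{pmatrix}1&0\\0&-1\end{pmatrix}+\lambda_1\begin{pmatrix}0&u\\-\overline u&0\end{pmatrix}\right]\psi,\qquad \psi:\mathbb{R}\to\mathbb{C}^2 .$$ There is exactly one bounded function $\varphi_-=\varphi_-(\cdot\,;\lambda_1):\mathbb{R}\to\mathbb{C}^2$ (the Jost function) such that $\varphi_-(x)e^{-i\lambda_1^2x}$ solves this problem and $\varphi_-(x)\to(1,0)^t$ as $x\to-\infty$. Put $\eta(x)=\varphi_-(x;\lambda_1)e^{-i\lambda_1^2x}$. For $\lambda\in\mathbb{C}$ and $\xi=(\xi_1,\xi_2)^t\in\mathbb{C}^2$ let $$d_\lambda(\xi,\xi)=\lambda|\xi_1|^2+\overline\lambda|\xi_2|^2,\quad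 G_\lambda(\xi)=\frac{d_{\overline\lambda}(\xi,\xi)}{d_\lambda(\xi,\xi)},\quad S_\lambda(\xi)=2i(\lambda^2-\overline\lambda^2)\frac{\xi_1\overline{\xi}_2}{d_\lambda(\xi,\xi)},$$ and, for a vector function $\xi:\mathbb{R}\to\mathbb{C}^2$, let $\mathbf{B}_\lambda(\xi)$ be the map on functions $v:\mathbb{R}\to\mathbb{C}$ given by $\mathbf{B}_\lambda(\xi)v=G_\lambda(\xi)\,[-G_\lambda(\xi)v+S_\lambda(\xi)]$. Then: 1. $d_{\lambda_1}(\eta(x),\eta(x))\neq0$ for all $x\in\mathbb{R}$, and $u^{(1)}=\mathbf{B}_{\lambda_1}(\eta)u$ belongs to $H^2(\mathbb{R})\cap H^{1,1}(\mathbb{R})$. (Nothing is assumed about the scattering coefficient $a(\lambda_1)=\lim_{x\to+\infty}\varphi_{-,1}(x;\lambda_1)$, which may or may not vanish.) 2. There are continuous functions $k_1,k_2:\mathbb{R}\to\mathbb{C}\setminus\{0\}$ with $|k_1|=|k_2|$ such that, with $\eta^*=(k_1\overline{\eta}_2,\,k_2\overline{\eta}_1)^t$, the map $\mathbf{B}_{\lambda_1}(\eta^*)$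 is a left inverse of $\mathbf{B}_{\lambda_1}(\eta)$, i.e. $\mathbf{B}_{\lambda_1}(\eta^*)\mathbf{B}_{\lambda_1}(\eta)v=v$ for every $v:\mathbb{R}\to\mathbb{C}$; in particular $\mathbf{B}_{\lambda_1}(\eta^*)u^{(1)}=u$. 3. More precisely, for any functions $k_1,k_2:\mathbb{R}\to\mathbb{C}\setminus\{0\}$ with $|k_1|=|k_2|$, the map $\mathbf{B}_{\lambda_1}(\eta^*)$ with $\eta^*=(k_1\overline{\eta}_2,\,k_2\overline{\eta}_1)^t$ is a left inverse of $\mathbf{B}_{\lambda_1}(\eta)$ if and only if $k_1(x)=G_{\lambda_1}(\eta(x))\,k_2(x)$ at every $x$ with $\eta_1(x)\eta_2(x)\neq0$. -/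

import Mathlib

open MeasureTheory Filter Topology
open scoped ContDiff Matrix ComplexConjugate

namespace KaupNewell

noncomputable section

/-- `v` is the weak derivative on `ℝ` of the locally integrable function `u`. -/
def HasWeakDeriv (u v : ℝ → ℂ) : Prop :=
  LocallyIntegrable u volume ∧ LocallyIntegrable v volume ∧
    ∀ θ : ℝ → ℝ, ContDiff ℝ ∞ θ → HasCompactSupport θ →
      ∫ x, deriv θ x • u x = - ∫ x, θ x • v x

/-- `u ∈ H²(ℝ)`: `u` and its first two weak derivatives are square integrable. -/
def MemH2 (u : ℝ → ℂ) : Prop :=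
  MemLp u 2 volume ∧ ∃ u₁ u₂ : ℝ → ℂ, HasWeakDeriv u u₁ ∧ HasWeakDeriv u₁ u₂ ∧
    MemLp u₁ 2 volume ∧ MemLp u₂ 2 volume

/-- `u ∈ L^{2,1}(ℝ)`: `⟨x⟩ u` is square integrable, where `⟨x⟩ = (1 + x²)^{1/2}`. -/
def MemL21 (u : ℝ → ℂ) : Prop :=
  MemLp (fun x : ℝ => Real.sqrt (1 + x ^ 2) • u x) 2 volume

/-- `u ∈ H^{1,1}(ℝ)`: `u` and its weak derivative lie in `L^{2,1}(ℝ)`. -/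
def MemH11 (u : ℝ → ℂ) : Prop :=
  MemL21 u ∧ ∃ u₁ : ℝ → ℂ, HasWeakDeriv u u₁ ∧ MemL21 u₁

/-- The Pauli matrix `σ₃`. -/
def sigma3 : Matrix (Fin 2) (Fin 2) ℂ := !![1, 0; 0, -1]

/-- The matrix `Q(z)` of the potential, at a point where the potential has the value `z`. -/
def Q (z : ℂ) : Matrix (Fin 2) (Fin 2) ℂ := !![0, z; -conj z, 0]

/-- `ψ` solves the Kaup–Newell spectral problem
`∂ₓψ = [-i lam² σ₃ + lam Q(u)] ψ` on `ℝ`, in integrated form: for locally integrable `u` this says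
that `ψ` is locally absolutely continuous and satisfies the equation almost everywhere (everywhere
if `u` is continuous). -/
def IsKNSolution (u : ℝ → ℂ) (lam : ℂ) (ψ : ℝ → Fin 2 → ℂ) : Prop :=
  Continuous ψ ∧ ∀ x y : ℝ,
    ψ y - ψ x = ∫ t in x..y, ((-Complex.I * lam ^ 2) • sigma3 + lam • Q (u t)) *ᵥ ψ t

/-- The scalar factor `e^{-i lam² x}`. -/
def expFactor (lam : ℂ) (x : ℝ) : ℂ := Complex.exp (-Complex.I * lam ^ 2 * x)

/-- `φ` is the Jost function `φ₋(·; lam)` of the potential `u`: `φ e^{-i lam² x}` solves the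
Kaup–Newell spectral problem, `φ` is bounded, and `φ(x) → e₁` as `x → -∞`. -/
def IsJostMinus (u : ℝ → ℂ) (lam : ℂ) (φ : ℝ → Fin 2 → ℂ) : Prop :=
  IsKNSolution u lam (fun x => expFactor lam x • φ x) ∧
    (∃ C : ℝ, ∀ x, ‖φ x‖ ≤ C) ∧ Tendsto φ atBot (𝓝 ![1, 0])

/-- The form `d_lam(η, ξ) = lam η₁ ξ̄₁ + conj(lam) η₂ ξ̄₂` on `ℂ²`. -/
def d (lam : ℂ) (η ξ : Fin 2 → ℂ) : ℂ :=
  lam * η 0 * conj (ξ 0) + conj lam * η 1 * conj (ξ 1)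

/-- `G_lam(η) = d_{conj lam}(η, η) / d_lam(η, η)`. -/
def G (lam : ℂ) (η : Fin 2 → ℂ) : ℂ := d (conj lam) η η / d lam η η

/-- `S_lam(η) = 2i (lam² - conj(lam)²) η₁ η̄₂ / d_lam(η, η)`. -/
def S (lam : ℂ) (η : Fin 2 → ℂ) : ℂ :=
  2 * Complex.I * (lam ^ 2 - conj lam ^ 2) * (η 0 * conj (η 1) / d lam η η)

/-- The Bäcklund transformation `B_lam(η) : v ↦ G_lam(η) [-G_lam(η) v + S_lam(η)]`
for a given vector function `η`. -/
def backlund (lam : ℂ) (η : ℝ → Fin 2 → ℂ) (v : ℝ → ℂ) : ℝ → ℂ :=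
  fun x => G lam (η x) * (-G lam (η x) * v x + S lam (η x))

/-- The vector function `η* = (k₁ η̄₂, k₂ η̄₁)`. -/
def etaStar (k₁ k₂ : ℝ → ℂ) (η : ℝ → Fin 2 → ℂ) : ℝ → Fin 2 → ℂ :=
  fun x => ![k₁ x * conj (η x 1), k₂ x * conj (η x 0)]

end

end KaupNewell

/-!
For a solution `η` without zeros of the Kaup–Newell problem, `G_lam(η)` and `S_lam(η)` depend only
on the line spanned by `η`, that is, on `p = (|η₁|² - |η₂|²) / |η|²` and `q = η₁ η̄₂ / |η|²`,
which satisfy `p² + 4 |q|² = 1`. With `h = |η|² / d_lam(η, η)`, a smooth function of `p` bounded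
by `1 / re lam`, one has `G_lam(η) = 2 (re lam) h - 1` and `S_lam(η) = 2i (lam² - conj lam²) h q`.
The derivatives of `p` and `q` are polynomials in `p`, `q`, `u` and conjugates
(`hasDerivAt_polar_and_cross`); hence the regularity and decay of the transformed potential follow
from those of `u` once `q ∈ L^{2,1}` is known.

No hypothesis on the scattering coefficient enters that bound. One has
`p' = 8 im(lam²) |q|² + O(|u| |q|)`, so `p` increases up to an error controlled by `|u|²`. Since
`p → 1` at `-∞`, and necessarily `p → 1` or `p → -1` at `+∞`, integrating `(1 + x²) p'` by parts against `p ∓ 1` bounds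
`∫ (1 + x²) |q|²` (`integrable_weight_of_tendsto_atBot`).

The Jost function is a fixed point of a Volterra operator that becomes a contraction after
conjugation with the weight `exp (K ∫_{-∞}^x |u|)` (`exists_volterra_system`). It is unique
because the Wronskian of two Jost solutions is constant and vanishes at `-∞`, and it has no zeros
because a solution that vanishes at a point is zero; then `re d_lam(η, η) = re lam |η|² > 0`.

Weak derivatives are handled through locally absolutely continuous representatives
(`HasWeakDeriv.exists_hasIntDeriv`, `HasIntDeriv.mul`).

Finally, `G_lam(η*) = 1 / G_lam(η)` whenever `|k₁| = |k₂| ≠ 0`, so that `B_lam(η*) B_lam(η)` is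
the translation by `G_lam(η*) (S_lam(η*) - S_lam(η))`, and the left inverse property is
`S_lam(η*) = S_lam(η)`.
-/

namespace KaupNewell

/-! ### Weak derivatives on the line -/

/-- `w` is locally absolutely continuous with almost everywhere derivative `g`, expressed by the
fundamental theorem of calculus. -/
def HasIntDeriv (w g : ℝ → ℂ) : Prop :=
  LocallyIntegrable g volume ∧ ∀ x y : ℝ, w y - w x = ∫ t in x..y, g t

theorem intervalIntegrable_of_locallyIntegrable {E : Type*} [NormedAddCommGroup E] {g : ℝ → E}
    (hg : LocallyIntegrable g volume) (a b : ℝ) : IntervalIntegrable g volume a b :=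
  intervalIntegrable_iff.mpr <|
    (hg.integrableOn_isCompact isCompact_uIcc).mono_set Set.uIoc_subset_uIcc

/-- The complex-valued case, reduced to Mathlib's real-valued one by real and imaginary parts. -/
theorem absolutelyContinuousOnInterval_integral {g : ℝ → ℂ} {a b c : ℝ}
    (hg : IntervalIntegrable g volume a b) (hc : c ∈ Set.uIcc a b) :
    AbsolutelyContinuousOnInterval (fun x => ∫ t in c..x, g t) a b := by
  have hre : IntervalIntegrable (fun t => (g t).re) volume a b :=
    ⟨hg.1.re, hg.2.re⟩
  have him : IntervalIntegrable (fun t => (g t).im) volume a b :=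
    ⟨hg.1.im, hg.2.im⟩
  have hconst : ∀ z : ℂ, AbsolutelyContinuousOnInterval (fun _ : ℝ => z) a b := fun z =>
    (contDiff_const (n := 1)).contDiffOn.absolutelyContinuousOnInterval
  have h := ((hre.absolutelyContinuousOnInterval_intervalIntegral hc).fun_smul (hconst 1)).add
    ((him.absolutelyContinuousOnInterval_intervalIntegral hc).fun_smul (hconst Complex.I))
  rw [absolutelyContinuousOnInterval_iff] at h ⊢
  intro ε hε
  obtain ⟨δ, hδ, H⟩ := h ε hε
  refine ⟨δ, hδ, fun E hE hE2 => ?_⟩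
  have key : ∀ x ∈ Set.uIcc a b, ∫ t in c..x, g t =
      ((fun x => (∫ t in c..x, (g t).re) • (1:ℂ)) +
        fun x => (∫ t in c..x, (g t).im) • Complex.I) x := by
    intro x hx
    have hgi : IntervalIntegrable g volume c x := hg.mono_set (Set.uIcc_subset_uIcc hc hx)
    have h1 := Complex.reCLM.intervalIntegral_comp_comm hgi
    have h2 := Complex.imCLM.intervalIntegral_comp_comm hgi
    simp only [Complex.reCLM_apply, Complex.imCLM_apply] at h1 h2
    simp [h1, h2]
  convert H E hE hE2 using 3 with i hi
  · exact key _ (hE.1 i hi).1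
  · exact key _ (hE.1 i hi).2

namespace HasIntDeriv

variable {w g F F' : ℝ → ℂ}

theorem eq_add_integral (h : HasIntDeriv w g) (a x : ℝ) : w x = w a + ∫ t in a..x, g t := by
  rw [← h.2]; ring

theorem continuous (h : HasIntDeriv w g) : Continuous w := by
  have : w = fun x => w 0 + ∫ t in (0:ℝ)..x, g t := funext fun x => h.eq_add_integral 0 x
  rw [this]
  exact continuous_const.add (intervalIntegral.continuous_primitive
    (fun a b => intervalIntegrable_of_locallyIntegrable h.1 a b) 0)

theorem hasDerivAt (h : HasIntDeriv w g) (hg : Continuous g) (x : ℝ) : HasDerivAt w (g x) x := by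
  have : w = fun x => w 0 + ∫ t in (0:ℝ)..x, g t := funext fun x => h.eq_add_integral 0 x
  rw [this]
  exact (intervalIntegral.integral_hasDerivAt_right (hg.intervalIntegrable _ _)
    (hg.stronglyMeasurableAtFilter _ _) hg.continuousAt).const_add _

theorem congr_ae (h : HasIntDeriv w g) {g₁ : ℝ → ℂ} (hg : g =ᵐ[volume] g₁) :
    HasIntDeriv w g₁ :=
  ⟨h.1.congr hg, fun x y => by
    rw [h.2]; exact intervalIntegral.integral_congr_ae (hg.mono fun t ht _ => ht)⟩

theorem of_hasDerivAt (h : ∀ x, HasDerivAt w (g x) x) (hg : Continuous g) : HasIntDeriv w g :=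
  ⟨hg.locallyIntegrable, fun _ _ =>
    (intervalIntegral.integral_eq_sub_of_hasDerivAt (fun t _ => h t)
      (hg.intervalIntegrable _ _)).symm⟩

theorem add (h : HasIntDeriv w g) (h' : HasIntDeriv F F') :
    HasIntDeriv (fun x => w x + F x) (fun x => g x + F' x) :=
  ⟨h.1.add h'.1, fun x y => by
    rw [intervalIntegral.integral_add (intervalIntegrable_of_locallyIntegrable h.1 _ _)
      (intervalIntegrable_of_locallyIntegrable h'.1 _ _), ← h.2, ← h'.2]; ring⟩

/-- The product rule for a `C¹` factor and a locally absolutely continuous one: the difference of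
the two sides is absolutely continuous with almost everywhere vanishing derivative. -/
theorem mul (hF : ∀ x, HasDerivAt F (F' x) x) (hF' : Continuous F') (hw : HasIntDeriv w g) :
    HasIntDeriv (fun x => F x * w x) (fun x => F' x * w x + F x * g x) := by
  have hFc : Continuous F := continuous_iff_continuousAt.2 fun x => (hF x).continuousAt
  have hloc : LocallyIntegrable (fun x => F' x * w x + F x * g x) volume := by
    refine (hF'.mul hw.continuous).locallyIntegrable.add ?_
    rw [locallyIntegrable_iff]
    intro k hk
    exact (hw.1.integrableOn_isCompact hk).continuousOn_mul hFc.continuousOn hk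
  refine ⟨hloc, fun a b => ?_⟩
  have ha : a ∈ Set.uIcc a b := Set.left_mem_uIcc
  have hb : b ∈ Set.uIcc a b := Set.right_mem_uIcc
  have hconst : AbsolutelyContinuousOnInterval (fun _ : ℝ => w a) a b :=
    (contDiff_const (n := 1)).contDiffOn.absolutelyContinuousOnInterval
  have hwAC : AbsolutelyContinuousOnInterval w a b := by
    have : w = (fun _ => w a) + fun x => ∫ t in a..x, g t :=
      funext fun x => hw.eq_add_integral a x
    rw [this]
    exact hconst.add (absolutelyContinuousOnInterval_integral
      (intervalIntegrable_of_locallyIntegrable hw.1 a b) ha)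
  have hFAC : AbsolutelyContinuousOnInterval F a b := by
    refine ContDiffOn.absolutelyContinuousOnInterval (ContDiff.contDiffOn ?_)
    rw [contDiff_one_iff_deriv]
    refine ⟨fun x => (hF x).differentiableAt, ?_⟩
    rwa [show deriv F = F' from funext fun x => (hF x).deriv]
  have hvAC := (hFAC.fun_smul hwAC).sub (absolutelyContinuousOnInterval_integral
    (intervalIntegrable_of_locallyIntegrable hloc a b) ha)
  have hder : ∀ᵐ x, x ∈ Set.uIcc a b →
      HasDerivAt ((fun x => F x • w x) -
        fun x => ∫ t in a..x, (F' t * w t + F t * g t)) 0 x := by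
    filter_upwards [_root_.LocallyIntegrable.ae_hasDerivAt_integral hw.1,
      _root_.LocallyIntegrable.ae_hasDerivAt_integral hloc] with x h1 h2 _
    have hwd : HasDerivAt w (g x) x := by
      have : w = fun x => w a + ∫ t in a..x, g t := funext fun x => hw.eq_add_integral a x
      rw [this]
      exact (h1 a).const_add _
    have := ((hF x).mul hwd).sub (h2 a)
    rw [sub_self] at this
    exact this
  obtain ⟨C, hC⟩ := hvAC.const_of_ae_hasDerivAt_zero hder
  have h1 := hC a ha
  have h2 := hC b hb
  simp only [Pi.sub_apply, smul_eq_mul, intervalIntegral.integral_same, sub_zero] at h1 h2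
  change F b * w b - F a * w a = _
  rw [h1, ← h2]; ring

theorem hasWeakDeriv (hw : HasIntDeriv w g) : HasWeakDeriv w g := by
  refine ⟨hw.continuous.locallyIntegrable, hw.1, fun θ hθ hc => ?_⟩
  have hd : ∀ x, HasDerivAt (fun x => (θ x : ℂ)) ((deriv θ x : ℝ) : ℂ) x := fun x =>
    ((hθ.differentiable (by simp)) x).hasDerivAt.ofReal_comp
  have hdc : Continuous (deriv θ) := hθ.continuous_deriv (by simp)
  have hprod := HasIntDeriv.mul hd (Complex.continuous_ofReal.comp hdc) hw
  -- outside `(-(|R| + 1), |R| + 1]` the test function vanishes, and so do the boundary terms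
  obtain ⟨R, hR⟩ := hc.isCompact.isBounded.subset_closedBall (0 : ℝ)
  have hz : ∀ x, x ∉ Set.Ioc (-(|R| + 1)) (|R| + 1) → x ∉ tsupport θ := by
    intro x hx hx'
    have := hR hx'
    simp only [Metric.mem_closedBall, dist_zero_right, Real.norm_eq_abs] at this
    refine hx ⟨?_, ?_⟩
    · linarith [neg_abs_le x, le_abs_self R]
    · linarith [le_abs_self x, le_abs_self R]
  have hθ0 : ∀ x, x ∉ tsupport θ → θ x = 0 := fun x hx => image_eq_zero_of_notMem_tsupport hx
  have hθ0' : ∀ x, x ∉ tsupport θ → deriv θ x = 0 := fun x hx =>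
    image_eq_zero_of_notMem_tsupport fun h => hx (tsupport_deriv_subset h)
  have hi1 : Integrable (fun x => deriv θ x • w x) volume := by
    refine Continuous.integrable_of_hasCompactSupport (hdc.smul hw.continuous) ?_
    exact hc.deriv.smul_right
  have hi2 : Integrable (fun x => θ x • g x) volume :=
    hw.1.integrable_smul_left_of_hasCompactSupport hθ.continuous hc
  rw [eq_neg_iff_add_eq_zero, ← integral_add hi1 hi2]
  have hend := hprod.2 (-(|R| + 1)) (|R| + 1)
  rw [intervalIntegral.integral_of_le (by linarith [abs_nonneg R]),
    setIntegral_eq_integral_of_forall_compl_eq_zero] at hend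
  · simp only [Complex.real_smul]
    rw [← hend]
    have e1 : θ (|R| + 1) = 0 := by
      refine hθ0 _ fun h => ?_
      have := hR h
      simp only [Metric.mem_closedBall, dist_zero_right, Real.norm_eq_abs] at this
      linarith [le_abs_self R, le_abs_self (|R| + 1)]
    have e2 : θ (-(|R| + 1)) = 0 := hθ0 _ (hz _ (by simp))
    change (θ (|R| + 1) : ℂ) * w (|R| + 1) - (θ (-(|R| + 1)) : ℂ) * w (-(|R| + 1)) = 0
    rw [e1, e2]; simp
  · intro x hx
    simp [hθ0 _ (hz x hx), hθ0' _ (hz x hx)]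

end HasIntDeriv

theorem HasWeakDeriv.congr_ae {u v u' : ℝ → ℂ} (h : HasWeakDeriv u v)
    (hu : u =ᵐ[volume] u') : HasWeakDeriv u' v := by
  refine ⟨h.1.congr hu, h.2.1, fun θ hθ hc => ?_⟩
  rw [← h.2.2 θ hθ hc]
  exact integral_congr_ae (hu.mono fun x hx => by simp [hx])

theorem HasWeakDeriv.ae_unique {u v v' : ℝ → ℂ} (h : HasWeakDeriv u v) (h' : HasWeakDeriv u v') :
    v =ᵐ[volume] v' :=
  ae_eq_of_integral_contDiff_smul_eq h.2.1 h'.2.1 fun θ hθ hc =>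
    neg_injective ((h.2.2 θ hθ hc).symm.trans (h'.2.2 θ hθ hc))

/-- du Bois-Reymond: a function with vanishing weak derivative is almost everywhere constant.
A test function of zero mean is the derivative of a test function, and an arbitrary one is brought
to zero mean by subtracting a multiple of a fixed bump. -/
theorem ae_const_of_hasWeakDeriv_zero {f : ℝ → ℂ} (hf : HasWeakDeriv f 0) :
    ∃ c : ℂ, f =ᵐ[volume] fun _ => c := by
  let B : ContDiffBump (0 : ℝ) := default
  set ρ : ℝ → ℝ := B.normed volume with hρ
  have hρd : ContDiff ℝ ∞ ρ := B.contDiff_normed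
  have hρc : HasCompactSupport ρ := B.hasCompactSupport_normed
  have hρ1 : ∫ x, ρ x = 1 := B.integral_normed
  refine ⟨∫ x, ρ x • f x, ?_⟩
  refine ae_eq_of_integral_contDiff_smul_eq hf.1 continuous_const.locallyIntegrable ?_
  intro θ hθ hθc
  have hθi : Integrable θ := hθ.continuous.integrable_of_hasCompactSupport hθc
  have hρi : Integrable ρ := hρd.continuous.integrable_of_hasCompactSupport hρc
  set I : ℝ := ∫ x, θ x with hI
  set k : ℝ → ℝ := fun x => θ x - I * ρ x with hk
  have hkd : ContDiff ℝ ∞ k := hθ.sub (contDiff_const.mul hρd)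
  have hkc : HasCompactSupport k := hθc.sub (hρc.mul_left)
  have hki : Integrable k := hkd.continuous.integrable_of_hasCompactSupport hkc
  have hk0 : ∫ x, k x = 0 := by
    rw [hk, integral_sub hθi (hρi.const_mul I), integral_const_mul, hρ1]; simp [hI]
  set K : ℝ → ℝ := fun x => ∫ t in Set.Iic x, k t with hK
  have hKeq : ∀ x, K x = K 0 + ∫ t in (0:ℝ)..x, k t := by
    intro x
    rw [← intervalIntegral.integral_Iic_sub_Iic hki.integrableOn hki.integrableOn]
    simp [hK]
  have hKder : ∀ x, HasDerivAt K (k x) x := by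
    intro x
    rw [show K = fun x => K 0 + ∫ t in (0:ℝ)..x, k t from funext hKeq]
    exact (intervalIntegral.integral_hasDerivAt_right (hkd.continuous.intervalIntegrable _ _)
      (hkd.continuous.stronglyMeasurableAtFilter _ _) hkd.continuous.continuousAt).const_add _
  have hKd : deriv K = k := funext fun x => (hKder x).deriv
  have hKsm : ContDiff ℝ ∞ K := by
    rw [contDiff_infty_iff_deriv, hKd]
    exact ⟨fun x => (hKder x).differentiableAt, hkd⟩
  have hKc : HasCompactSupport K := by
    obtain ⟨R, hR⟩ := hkc.isCompact.isBounded.subset_closedBall (0 : ℝ)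
    have hz : ∀ x, R < |x| → k x = 0 := fun x hx =>
      image_eq_zero_of_notMem_tsupport fun h => by
        have := hR h
        simp only [Metric.mem_closedBall, dist_zero_right, Real.norm_eq_abs] at this
        linarith
    refine HasCompactSupport.of_support_subset_isCompact
      (isCompact_Icc (a := -R) (b := R)) ?_
    intro x hx
    by_contra hx'
    refine hx ?_
    rw [Set.mem_Icc, not_and_or, not_le, not_le] at hx'
    rcases hx' with hx' | hx'
    · refine setIntegral_eq_zero_of_forall_eq_zero fun t ht => hz t ?_
      have : t ≤ x := ht
      linarith [neg_abs_le t]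
    · rw [← hk0]
      refine setIntegral_eq_integral_of_forall_compl_eq_zero fun t ht => hz t ?_
      have : x < t := by simpa using ht
      linarith [le_abs_self t]
  have h := hf.2.2 K hKsm hKc
  rw [hKd] at h
  simp only [Pi.zero_apply, smul_zero, integral_zero, neg_zero] at h
  have hi1 : Integrable (fun x => θ x • f x) volume :=
    hf.1.integrable_smul_left_of_hasCompactSupport hθ.continuous hθc
  have hi2 : Integrable (fun x => ρ x • f x) volume :=
    hf.1.integrable_smul_left_of_hasCompactSupport hρd.continuous hρc
  have h3 : ∫ x, k x • f x = (∫ x, θ x • f x) - I • ∫ x, ρ x • f x := by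
    have := integral_sub hi1 (hi2.smul I)
    simp only [Pi.smul_apply] at this
    rw [← integral_smul, ← this]
    refine integral_congr_ae (Eventually.of_forall fun x => ?_)
    simp only [hk, sub_smul, mul_smul]
  rw [h3, sub_eq_zero] at h
  rw [h, integral_smul_const]

/-- A function with a locally integrable weak derivative has a locally absolutely continuous
representative. -/
theorem HasWeakDeriv.exists_hasIntDeriv {u v : ℝ → ℂ} (h : HasWeakDeriv u v) :
    ∃ U : ℝ → ℂ, HasIntDeriv U v ∧ u =ᵐ[volume] U := by
  have hV : HasIntDeriv (fun x => ∫ t in (0:ℝ)..x, v t) v := by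
    refine ⟨h.2.1, fun x y => ?_⟩
    exact intervalIntegral.integral_interval_sub_left
      (intervalIntegrable_of_locallyIntegrable h.2.1 _ _)
      (intervalIntegrable_of_locallyIntegrable h.2.1 _ _)
  have hVw := hV.hasWeakDeriv
  have h0 : HasWeakDeriv (u - fun x => ∫ t in (0:ℝ)..x, v t) 0 := by
    refine ⟨h.1.sub hVw.1, locallyIntegrable_zero, fun θ hθ hc => ?_⟩
    have hdc : Continuous (deriv θ) := hθ.continuous_deriv (by simp)
    have e1 := h.1.integrable_smul_left_of_hasCompactSupport hdc hc.deriv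
    have e2 := hVw.1.integrable_smul_left_of_hasCompactSupport hdc hc.deriv
    simp only [Pi.sub_apply, smul_sub, Pi.zero_apply, smul_zero, integral_zero, neg_zero]
    rw [integral_sub e1 e2, h.2.2 θ hθ hc, hVw.2.2 θ hθ hc, sub_self]
  obtain ⟨c, hc⟩ := ae_const_of_hasWeakDeriv_zero h0
  refine ⟨fun x => c + ∫ t in (0:ℝ)..x, v t, ⟨h.2.1, fun x y => ?_⟩, ?_⟩
  · rw [← hV.2]; ring
  · filter_upwards [hc] with x hx
    rw [← hx]; simp

/-! ### Weighted integrability from a differential inequality -/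

theorem continuous_of_forall_hasDerivAt {E : Type*} [NormedAddCommGroup E] [NormedSpace ℝ E]
    {f f' : ℝ → E} (h : ∀ x, HasDerivAt f (f' x) x) : Continuous f :=
  continuous_iff_continuousAt.2 fun x => (h x).continuousAt

theorem hasDerivAt_weight_mul_sub {p D : ℝ → ℝ} (hp : ∀ x, HasDerivAt p (D x) x) (c x : ℝ) :
    HasDerivAt (fun x => (1 + x ^ 2) * (p x - c)) (2 * x * (p x - c) + (1 + x ^ 2) * D x) x := by
  have h1 : HasDerivAt (fun x : ℝ => 1 + x ^ 2) (2 * x) x := by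
    simpa using (hasDerivAt_pow 2 x).const_add 1
  exact h1.mul ((hp x).sub_const c)

theorem intervalIntegral_le_integral_of_nonneg {f : ℝ → ℝ} (hf : Integrable f) (h0 : ∀ x, 0 ≤ f x)
    {a b : ℝ} (hab : a ≤ b) : ∫ x in a..b, f x ≤ ∫ x, f x := by
  rw [intervalIntegral.integral_of_le hab]
  exact setIntegral_le_integral hf (Eventually.of_forall h0)

/-- If `κ s ≤ p' + r` and `p ≤ 1` tends to `1` at `-∞`, then `s` inherits the weighted integrability
of `r` on the negative half-line: integrate `(1 + x²) p'` by parts against `p - 1`. The boundary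
term is controlled because `1 - p(a) ≤ ∫ r` over `(-∞, a]`, and the remaining term has a sign. -/
theorem integrableOn_Iic_weight {p D s r : ℝ → ℝ} {κ : ℝ}
    (hp : ∀ x, HasDerivAt p (D x) x) (hD : Continuous D) (hs : Continuous s) (hr : Continuous r)
    (hs0 : ∀ x, 0 ≤ s x) (hr0 : ∀ x, 0 ≤ r x) (hκ : 0 < κ) (hp1 : ∀ x, p x ≤ 1)
    (hle : ∀ x, κ * s x ≤ D x + r x)
    (hri : Integrable fun x => (1 + x ^ 2) * r x) (hlim : Tendsto p atBot (𝓝 1)) :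
    IntegrableOn (fun x => (1 + x ^ 2) * s x) (Set.Iic 0) := by
  have hpc := continuous_of_forall_hasDerivAt hp
  set M := ∫ x, (1 + x ^ 2) * r x with hM
  have hw0 : ∀ x, 0 ≤ (1 + x ^ 2) * r x := fun x => mul_nonneg (by positivity) (hr0 x)
  -- the boundary term at `a`: let `y → -∞` in `p(y) - p(a) ≤ ∫ r` over `[y, a]`
  have hbd : ∀ a ≤ (0:ℝ), (1 + a ^ 2) * (1 - p a) ≤ M := by
    intro a ha
    have hlim' : Tendsto (fun y => (1 + a ^ 2) * (p y - p a)) atBot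
        (𝓝 ((1 + a ^ 2) * (1 - p a))) := (hlim.sub_const _).const_mul _
    refine le_of_tendsto hlim' ?_
    filter_upwards [eventually_le_atBot a] with y hy
    have h1 : ∫ x in y..a, D x = p a - p y :=
      intervalIntegral.integral_eq_sub_of_hasDerivAt (fun t _ => hp t) (hD.intervalIntegrable _ _)
    have h2 : (1 + a ^ 2) * (p y - p a) = ∫ x in y..a, (1 + a ^ 2) * (-D x) := by
      rw [intervalIntegral.integral_const_mul, intervalIntegral.integral_neg, h1]; ring
    rw [h2]
    refine le_trans (intervalIntegral.integral_mono_on hy ?_ ?_ ?_)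
      (intervalIntegral_le_integral_of_nonneg hri hw0 hy)
    · exact Continuous.intervalIntegrable (by fun_prop) _ _
    · exact Continuous.intervalIntegrable (by fun_prop) _ _
    · intro x hx
      have h3 : -D x ≤ r x := by nlinarith [hle x, hs0 x]
      have h4 : a ^ 2 ≤ x ^ 2 := by nlinarith [hx.2]
      calc (1 + a ^ 2) * (-D x) ≤ (1 + a ^ 2) * r x := by gcongr
        _ ≤ (1 + x ^ 2) * r x := by gcongr; exact hr0 x
  refine integrableOn_Iic_of_intervalIntegral_norm_bounded (l := atBot) (a := id)
    (2 * M / κ) 0 (fun i => ?_) tendsto_id ?_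
  · exact (Continuous.integrableOn_Icc (by fun_prop)).mono_set Set.Ioc_subset_Icc_self
  · filter_upwards [eventually_le_atBot 0] with a ha
    have e1 : ∫ x in a..0, (2 * x * (p x - 1) + (1 + x ^ 2) * D x)
        = (1 + (0:ℝ) ^ 2) * (p 0 - 1) - (1 + a ^ 2) * (p a - 1) :=
      intervalIntegral.integral_eq_sub_of_hasDerivAt
        (fun t _ => hasDerivAt_weight_mul_sub hp 1 t)
        (Continuous.intervalIntegrable (by fun_prop) _ _)
    have e2 : ∫ x in a..0, κ * ((1 + x ^ 2) * s x) ≤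
        ∫ x in a..0, ((2 * x * (p x - 1) + (1 + x ^ 2) * D x) + (1 + x ^ 2) * r x) := by
      refine intervalIntegral.integral_mono_on ha ?_ ?_ ?_
      · exact Continuous.intervalIntegrable (by fun_prop) _ _
      · exact Continuous.intervalIntegrable (by fun_prop) _ _
      · intro x hx
        have h1 : 0 ≤ 2 * x * (p x - 1) := by nlinarith [hx.2, hp1 x]
        have h2 := mul_le_mul_of_nonneg_left (hle x) (by positivity : 0 ≤ 1 + x ^ 2)
        linarith
    rw [intervalIntegral.integral_const_mul, intervalIntegral.integral_add
      (Continuous.intervalIntegrable (by fun_prop) _ _)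
      (Continuous.intervalIntegrable (by fun_prop) _ _), e1] at e2
    have e3 := intervalIntegral_le_integral_of_nonneg hri hw0 ha
    have e4 := hbd a ha
    have e5 := hp1 0
    have e6 : ∫ x in id a..0, ‖(1 + x ^ 2) * s x‖ = ∫ x in a..0, (1 + x ^ 2) * s x := by
      refine intervalIntegral.integral_congr fun x _ => ?_
      exact Real.norm_of_nonneg (mul_nonneg (by positivity) (hs0 x))
    rw [e6, le_div_iff₀ hκ]
    linarith

/-- The stable case at `+∞`. Here `1 - p ≤ 4 s` for large `x`, so that the term
`2 x (1 - p)` left by the integration by parts is absorbed by `κ (1 + x²) s`. -/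
theorem integrableOn_Ioi_weight {p D s r : ℝ → ℝ} {κ : ℝ}
    (hp : ∀ x, HasDerivAt p (D x) x) (hD : Continuous D) (hs : Continuous s) (hr : Continuous r)
    (hs0 : ∀ x, 0 ≤ s x) (hr0 : ∀ x, 0 ≤ r x) (hκ : 0 < κ) (hp1 : ∀ x, |p x| ≤ 1)
    (hps : ∀ x, 4 * s x = 1 - p x ^ 2)
    (hle : ∀ x, κ * s x ≤ D x + r x)
    (hri : Integrable fun x => (1 + x ^ 2) * r x) (hlim : Tendsto p atTop (𝓝 1)) :
    IntegrableOn (fun x => (1 + x ^ 2) * s x) (Set.Ioi 0) := by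
  have hpc := continuous_of_forall_hasDerivAt hp
  set M := ∫ x, (1 + x ^ 2) * r x with hM
  have hw0 : ∀ x, 0 ≤ (1 + x ^ 2) * r x := fun x => mul_nonneg (by positivity) (hr0 x)
  obtain ⟨X, hX⟩ := eventually_atTop.1 ((hlim.eventually (lt_mem_nhds (zero_lt_one' ℝ))).and
    (eventually_ge_atTop 0))
  have hX0 : 0 ≤ X := (hX X le_rfl).2
  -- `8 x ≤ (κ / 2) x² + 32 / κ`, and the unweighted remainder `(32 / κ) s` is at most
  -- `(32 / κ²) (p' + r)`
  set c := 32 / κ ^ 2 with hc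
  have hc0 : 0 ≤ c := by positivity
  have key : IntegrableOn (fun x => (1 + x ^ 2) * s x) (Set.Ioi X) := by
    refine integrableOn_Ioi_of_intervalIntegral_norm_bounded (l := atTop) (b := id)
      (((1 + X ^ 2) * 2 + 2 * c + (1 + c) * M) / (κ / 2)) X (fun i => ?_) tendsto_id ?_
    · exact (Continuous.integrableOn_Icc (by fun_prop)).mono_set Set.Ioc_subset_Icc_self
    filter_upwards [eventually_ge_atTop X] with y hy
    have e1 : ∫ x in X..y, (2 * x * (p x - 1) + (1 + x ^ 2) * D x)
        = (1 + y ^ 2) * (p y - 1) - (1 + X ^ 2) * (p X - 1) :=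
      intervalIntegral.integral_eq_sub_of_hasDerivAt
        (fun t _ => hasDerivAt_weight_mul_sub hp 1 t)
        (Continuous.intervalIntegrable (by fun_prop) _ _)
    have e1' : ∫ x in X..y, D x = p y - p X :=
      intervalIntegral.integral_eq_sub_of_hasDerivAt (fun t _ => hp t) (hD.intervalIntegrable _ _)
    have e2 : ∫ x in X..y, κ / 2 * ((1 + x ^ 2) * s x) ≤
        ∫ x in X..y, ((2 * x * (p x - 1) + (1 + x ^ 2) * D x) + c * D x +
          (1 + c) * ((1 + x ^ 2) * r x)) := by
      refine intervalIntegral.integral_mono_on hy ?_ ?_ ?_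
      · exact Continuous.intervalIntegrable (by fun_prop) _ _
      · exact Continuous.intervalIntegrable (by fun_prop) _ _
      · intro x hx
        have hx0 : 0 ≤ x := hX0.trans hx.1
        have hpx : 0 ≤ p x := (hX x hx.1).1.le
        have hpx1 : p x ≤ 1 := (abs_le.1 (hp1 x)).2
        have h1 : 1 - p x ≤ 4 * s x := by nlinarith [hps x]
        have h2 := mul_le_mul_of_nonneg_left (hle x) (by positivity : 0 ≤ 1 + x ^ 2)
        have h3 : 8 * x ≤ κ / 2 * x ^ 2 + 32 / κ := by
          have : 0 ≤ (κ * x - 8) ^ 2 / (2 * κ) := by positivity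
          have e : (κ * x - 8) ^ 2 / (2 * κ) = κ / 2 * x ^ 2 + 32 / κ - 8 * x := by
            field_simp; ring
          linarith
        have h4 : 2 * x * (1 - p x) ≤ (κ / 2 * x ^ 2 + 32 / κ) * s x := by
          calc 2 * x * (1 - p x) ≤ 2 * x * (4 * s x) := by gcongr
            _ = 8 * x * s x := by ring
            _ ≤ _ := by gcongr; exact hs0 x
        have h5 : 32 / κ * s x ≤ c * (D x + r x) := by
          have : 32 / κ * s x = c * (κ * s x) := by rw [hc]; field_simp
          rw [this]; exact mul_le_mul_of_nonneg_left (hle x) hc0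
        have h6 : c * r x ≤ c * ((1 + x ^ 2) * r x) := by
          refine mul_le_mul_of_nonneg_left ?_ hc0
          nlinarith [hr0 x, sq_nonneg x, mul_nonneg (sq_nonneg x) (hr0 x)]
        have h7 : 0 ≤ κ / 2 * s x := by have := hs0 x; positivity
        nlinarith
    rw [intervalIntegral.integral_const_mul, intervalIntegral.integral_add
      (Continuous.intervalIntegrable (by fun_prop) _ _)
      (Continuous.intervalIntegrable (by fun_prop) _ _), intervalIntegral.integral_add
      (Continuous.intervalIntegrable (by fun_prop) _ _)
      (Continuous.intervalIntegrable (by fun_prop) _ _), intervalIntegral.integral_const_mul,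
      intervalIntegral.integral_const_mul, e1, e1'] at e2
    have e3 := intervalIntegral_le_integral_of_nonneg hri hw0 hy
    have e6 : ∫ x in X..id y, ‖(1 + x ^ 2) * s x‖ = ∫ x in X..y, (1 + x ^ 2) * s x := by
      refine intervalIntegral.integral_congr fun x _ => ?_
      exact Real.norm_of_nonneg (mul_nonneg (by positivity) (hs0 x))
    rw [e6, le_div_iff₀ (by positivity)]
    have f1 : (1 + y ^ 2) * (p y - 1) ≤ 0 :=
      mul_nonpos_of_nonneg_of_nonpos (by positivity) (by linarith [(abs_le.1 (hp1 y)).2])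
    have f2 : (1 + X ^ 2) * (1 - p X) ≤ (1 + X ^ 2) * 2 := by
      gcongr; linarith [(abs_le.1 (hp1 X)).1]
    have f3 : c * (p y - p X) ≤ c * 2 := by
      gcongr; linarith [(abs_le.1 (hp1 X)).1, (abs_le.1 (hp1 y)).2]
    have f4 := mul_le_mul_of_nonneg_left e3 (by positivity : 0 ≤ 1 + c)
    linarith
  have hsplit : Set.Ioi (0:ℝ) = Set.Ioc 0 X ∪ Set.Ioi X := (Set.Ioc_union_Ioi_eq_Ioi hX0).symm
  rw [hsplit]
  exact ((Continuous.integrableOn_Icc (by fun_prop)).mono_set Set.Ioc_subset_Icc_self).union key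

/-- If `4 s = 1 - p²` and `κ s ≤ p' + r` with `r` integrable, then `p` tends to `1` or to `-1` at
`+∞`: `p + ∫ r` is monotone, so that `p` converges and `s` is integrable. -/
theorem tendsto_one_or_neg_one {p D s r : ℝ → ℝ} {κ : ℝ}
    (hp : ∀ x, HasDerivAt p (D x) x) (hs : Continuous s) (hr : Continuous r)
    (hs0 : ∀ x, 0 ≤ s x) (hr0 : ∀ x, 0 ≤ r x) (hκ : 0 < κ) (hp1 : ∀ x, |p x| ≤ 1)
    (hps : ∀ x, 4 * s x = 1 - p x ^ 2) (hle : ∀ x, κ * s x ≤ D x + r x) (hri : Integrable r) :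
    Tendsto p atTop (𝓝 1) ∨ Tendsto p atTop (𝓝 (-1)) := by
  set P : ℝ → ℝ := fun x => p x + ∫ t in (0:ℝ)..x, r t with hP
  have hPd : ∀ x, HasDerivAt P (D x + r x) x := fun x =>
    (hp x).add (intervalIntegral.integral_hasDerivAt_right (hr.intervalIntegrable _ _)
      (hr.stronglyMeasurableAtFilter _ _) hr.continuousAt)
  have hPmono : Monotone P := monotone_of_hasDerivAt_nonneg hPd fun x => by
    have := hle x; have := hs0 x; simp only [Pi.zero_apply]; nlinarith
  have hrlim : Tendsto (fun x => ∫ t in (0:ℝ)..x, r t) atTop (𝓝 (∫ t in Set.Ioi 0, r t)) :=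
    intervalIntegral_tendsto_integral_Ioi 0 hri.integrableOn tendsto_id
  have hPbd : BddAbove (Set.range P) := by
    refine ⟨1 + ∫ t, r t, ?_⟩
    rintro _ ⟨x, rfl⟩
    have h1 := (abs_le.1 (hp1 x)).2
    have h2 : ∫ t in (0:ℝ)..x, r t ≤ ∫ t, r t := by
      rcases le_total 0 x with h | h
      · exact intervalIntegral_le_integral_of_nonneg hri hr0 h
      · have h3 : 0 ≤ ∫ t in x..0, r t := intervalIntegral.integral_nonneg h fun t _ => hr0 t
        rw [intervalIntegral.integral_symm]
        linarith [integral_nonneg (μ := volume) (f := r) fun t => hr0 t]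
    simp only [hP]; linarith
  have hPlim := tendsto_atTop_ciSup hPmono hPbd
  have hplim : Tendsto p atTop (𝓝 ((⨆ x, P x) - ∫ t in Set.Ioi 0, r t)) := by
    refine (hPlim.sub hrlim).congr fun x => ?_
    simp [hP]
  set L := (⨆ x, P x) - ∫ t in Set.Ioi 0, r t with hL
  have hPint : IntegrableOn (fun x => D x + r x) (Set.Ioi 0) := by
    refine integrableOn_Ioi_deriv_of_nonneg (hPd 0).continuousAt.continuousWithinAt
      (fun x _ => hPd x) (fun x _ => ?_) hPlim
    have := hle x; have := hs0 x; nlinarith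
  have hsint : IntegrableOn s (Set.Ioi 0) := by
    refine (hPint.const_mul (1 / κ)).mono' hs.aestronglyMeasurable
      (Eventually.of_forall fun x => ?_)
    rw [Real.norm_of_nonneg (hs0 x), one_div, ← div_eq_inv_mul, le_div_iff₀ hκ, mul_comm]
    exact hle x
  have hslim : Tendsto s atTop (𝓝 ((1 - L ^ 2) / 4)) := by
    refine (((hplim.pow 2).const_sub 1).div_const 4).congr fun x => ?_
    rw [← hps]; ring
  have h0 : (1 - L ^ 2) / 4 = 0 := by
    refine IntegrableAtFilter.eq_zero_of_tendsto (μ := volume) (l := atTop)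
      ⟨Set.Ioi 0, Ioi_mem_atTop 0, hsint⟩ (fun t ht => ?_) hslim
    obtain ⟨b, hb⟩ := mem_atTop_sets.1 ht
    exact measure_mono_top (s₁ := Set.Ici b) hb Real.volume_Ici
  have : L ^ 2 = 1 := by linarith
  rcases sq_eq_one_iff.1 this with h | h
  · left; rwa [h] at hplim
  · right; rwa [h] at hplim

/-- Weighted integrability on the whole line, whichever limit `±1` the function `p` has at `+∞`. -/
theorem integrable_weight_of_tendsto_atBot {p D s r : ℝ → ℝ} {κ : ℝ}
    (hp : ∀ x, HasDerivAt p (D x) x) (hD : Continuous D) (hs : Continuous s) (hr : Continuous r)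
    (hs0 : ∀ x, 0 ≤ s x) (hr0 : ∀ x, 0 ≤ r x) (hκ : 0 < κ) (hp1 : ∀ x, |p x| ≤ 1)
    (hps : ∀ x, 4 * s x = 1 - p x ^ 2)
    (hle : ∀ x, κ * s x ≤ D x + r x)
    (hri : Integrable fun x => (1 + x ^ 2) * r x) (hlim : Tendsto p atBot (𝓝 1)) :
    Integrable (fun x => (1 + x ^ 2) * s x) := by
  have hri' : Integrable r := hri.mono' hr.aestronglyMeasurable (Eventually.of_forall fun x => by
    rw [Real.norm_of_nonneg (hr0 x)]
    nlinarith [hr0 x, mul_nonneg (sq_nonneg x) (hr0 x)])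
  rw [← integrableOn_univ, ← Set.Iic_union_Ioi (a := (0:ℝ))]
  refine (integrableOn_Iic_weight hp hD hs hr hs0 hr0 hκ (fun x => (abs_le.1 (hp1 x)).2) hle hri
    hlim).union ?_
  rcases tendsto_one_or_neg_one hp hs hr hs0 hr0 hκ hp1 hps hle hri' with h | h
  · exact integrableOn_Ioi_weight hp hD hs hr hs0 hr0 hκ hp1 hps hle hri h
  · -- the reflection `p(x) ↦ -p(-x)` exchanges this case with the one at `-∞`
    have hpn : ∀ x, HasDerivAt (fun x => -p (-x)) (D (-x)) x := fun x => by
      have := ((hp (-x)).comp x (hasDerivAt_neg x)).neg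
      convert! this using 1
      ring
    have := integrableOn_Iic_weight (p := fun x => -p (-x)) (D := fun x => D (-x))
      (s := fun x => s (-x)) (r := fun x => r (-x)) (κ := κ) hpn (by fun_prop) (by fun_prop)
      (by fun_prop) (fun x => hs0 _) (fun x => hr0 _) hκ
      (fun x => by linarith [(abs_le.1 (hp1 (-x))).1]) (fun x => hle _)
      (by simpa using hri.comp_neg)
      (by simpa using (h.comp tendsto_neg_atBot_atTop).neg)
    have h2 := (integrableOn_Ici_iff_integrableOn_Ioi (μ := volume) (b := (0:ℝ))
      (f := fun x => (1 + x ^ 2) * s x)).1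
    refine h2 ?_
    have h3 := this.comp_neg
    simpa using h3

/-! ### Volterra integrals -/

open scoped BoundedContinuousFunction NNReal

/-- The solution of `y' = μ y + c` vanishing at `-∞`, for integrable `c` and `re μ ≤ 0`. -/
noncomputable def volterra (μ : ℂ) (c : ℝ → ℂ) (x : ℝ) : ℂ :=
  ∫ y in Set.Iic x, Complex.exp (μ * (x - y)) * c y

section Volterra

variable {μ : ℂ} {c : ℝ → ℂ}

theorem norm_exp_mul_sub_le_one (hμ : μ.re ≤ 0) {x y : ℝ} (h : y ≤ x) :
    ‖Complex.exp (μ * (x - y))‖ ≤ 1 := by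
  rw [Complex.norm_exp, Real.exp_le_one_iff, ← Complex.ofReal_sub, Complex.re_mul_ofReal]
  exact mul_nonpos_of_nonpos_of_nonneg hμ (by linarith)

theorem integrableOn_volterra (hμ : μ.re ≤ 0) (hc : Continuous c) (hci : Integrable c) (x : ℝ) :
    IntegrableOn (fun y : ℝ => Complex.exp (μ * (x - y)) * c y) (Set.Iic x) := by
  refine Integrable.mono' (g := fun y => ‖c y‖) hci.norm.integrableOn
    (Continuous.aestronglyMeasurable (by fun_prop)) ?_
  refine (ae_restrict_iff' measurableSet_Iic).2 (Eventually.of_forall fun y hy => ?_)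
  rw [norm_mul]
  exact mul_le_of_le_one_left (norm_nonneg _) (norm_exp_mul_sub_le_one hμ hy)

theorem norm_volterra_le (hμ : μ.re ≤ 0) (hci : Integrable c) (x : ℝ) :
    ‖volterra μ c x‖ ≤ ∫ y in Set.Iic x, ‖c y‖ := by
  refine norm_integral_le_of_norm_le hci.norm.integrableOn ?_
  refine (ae_restrict_iff' measurableSet_Iic).2 (Eventually.of_forall fun y hy => ?_)
  rw [norm_mul]
  exact mul_le_of_le_one_left (norm_nonneg _) (norm_exp_mul_sub_le_one hμ hy)

theorem hasDerivAt_integral_Iic {E : Type*} [NormedAddCommGroup E] [NormedSpace ℝ E]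
    [CompleteSpace E] {f : ℝ → E} (hf : Continuous f) (hfi : ∀ x, IntegrableOn f (Set.Iic x))
    (x : ℝ) : HasDerivAt (fun x => ∫ y in Set.Iic x, f y) (f x) x := by
  have : (fun x => ∫ y in Set.Iic x, f y) =
      fun x => (∫ y in Set.Iic 0, f y) + ∫ t in (0:ℝ)..x, f t := by
    funext x
    rw [← intervalIntegral.integral_Iic_sub_Iic (hfi 0) (hfi x)]
    abel
  rw [this]
  exact (intervalIntegral.integral_hasDerivAt_right (hf.intervalIntegrable _ _)
    (hf.stronglyMeasurableAtFilter _ _) hf.continuousAt).const_add _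

theorem hasDerivAt_volterra (hμ : μ.re ≤ 0) (hc : Continuous c) (hci : Integrable c) (x : ℝ) :
    HasDerivAt (volterra μ c) (c x + μ * volterra μ c x) x := by
  set f : ℝ → ℂ := fun y => Complex.exp (-μ * y) * c y with hf
  have hfc : Continuous f := by fun_prop
  have hexp : ∀ x y : ℝ, Complex.exp (μ * (x - y)) * c y = Complex.exp (μ * x) * f y := by
    intro x y
    simp only [hf]
    rw [← mul_assoc, ← Complex.exp_add]
    ring_nf
  have hfi : ∀ x, IntegrableOn f (Set.Iic x) := by
    intro x
    have h := (integrableOn_volterra hμ hc hci x).const_mul (Complex.exp (-(μ * x)))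
    refine h.congr (Eventually.of_forall fun y => ?_)
    simp only [hexp x y]
    rw [← mul_assoc, ← Complex.exp_add]
    simp
  have hV : volterra μ c = fun x : ℝ => Complex.exp (μ * x) * ∫ y in Set.Iic x, f y := by
    funext x
    simp only [volterra, hexp, integral_const_mul]
  have hE : HasDerivAt (fun x : ℝ => Complex.exp (μ * x)) (Complex.exp (μ * x) * μ) x := by
    simpa using ((hasDerivAt_id (x : ℂ)).const_mul μ).cexp.comp_ofReal
  rw [hV]
  convert! hE.mul (hasDerivAt_integral_Iic hfc hfi x) using 1
  simp only [hf]
  rw [← mul_assoc (Complex.exp (μ * x)) (Complex.exp (-μ * x)), ← Complex.exp_add]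
  simp
  ring

theorem tendsto_volterra_atBot (hμ : μ.re ≤ 0) (hci : Integrable c) :
    Tendsto (volterra μ c) atBot (𝓝 0) :=
  squeeze_zero_norm (norm_volterra_le hμ hci) (tendsto_integral_Iic_zero tendsto_id)

theorem volterra_sub (hμ : μ.re ≤ 0) {c' : ℝ → ℂ} (hc : Continuous c) (hci : Integrable c)
    (hc' : Continuous c') (hci' : Integrable c') (x : ℝ) :
    volterra μ (fun y => c y - c' y) x = volterra μ c x - volterra μ c' x := by
  simp only [volterra, mul_sub (Complex.exp _)]
  exact integral_sub (integrableOn_volterra hμ hc hci x) (integrableOn_volterra hμ hc' hci' x)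

/-- The cumulative mass `∫_{-∞}^x v` of a density. -/
noncomputable def mass (v : ℝ → ℝ) (x : ℝ) : ℝ := ∫ y in Set.Iic x, v y

variable {v : ℝ → ℝ}

theorem hasDerivAt_mass (hv : Continuous v) (hvi : Integrable v) (x : ℝ) :
    HasDerivAt (mass v) (v x) x :=
  hasDerivAt_integral_Iic hv (fun _ => hvi.integrableOn) x

theorem mass_nonneg (hv0 : ∀ x, 0 ≤ v x) (x : ℝ) : 0 ≤ mass v x :=
  integral_nonneg fun t => hv0 t

theorem mass_le (hvi : Integrable v) (hv0 : ∀ x, 0 ≤ v x) (x : ℝ) : mass v x ≤ ∫ t, v t :=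
  setIntegral_le_integral hvi (Eventually.of_forall hv0)

theorem integrable_exp_mass_mul {K : ℝ} (hK : 0 < K) (hv : Continuous v) (hvi : Integrable v)
    (hv0 : ∀ x, 0 ≤ v x) : Integrable fun x => Real.exp (K * mass v x) * v x := by
  have hm := continuous_of_forall_hasDerivAt (hasDerivAt_mass hv hvi)
  refine (hvi.const_mul (Real.exp (K * ∫ t, v t))).mono'
    (Continuous.aestronglyMeasurable (by fun_prop)) (Eventually.of_forall fun x => ?_)
  rw [Real.norm_of_nonneg (mul_nonneg (Real.exp_pos _).le (hv0 x))]
  have := mass_le hvi hv0 x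
  gcongr
  exact hv0 x

theorem integral_exp_mass_le {K : ℝ} (hK : 0 < K) (hv : Continuous v) (hvi : Integrable v)
    (hv0 : ∀ x, 0 ≤ v x) (x : ℝ) :
    ∫ y in Set.Iic x, Real.exp (K * mass v y) * v y ≤ Real.exp (K * mass v x) / K := by
  have hm := continuous_of_forall_hasDerivAt (hasDerivAt_mass hv hvi)
  refine le_of_tendsto (intervalIntegral_tendsto_integral_Iic x
    (integrable_exp_mass_mul hK hv hvi hv0).integrableOn tendsto_id)
    (Eventually.of_forall fun a => ?_)
  have hd : ∀ y, HasDerivAt (fun y => Real.exp (K * mass v y) / K)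
      (Real.exp (K * mass v y) * v y) y := by
    intro y
    convert! (((hasDerivAt_mass hv hvi y).const_mul K).exp).div_const K using 1
    field_simp
  rw [intervalIntegral.integral_eq_sub_of_hasDerivAt (fun y _ => hd y)
    (Continuous.intervalIntegrable (by fun_prop) _ _)]
  have : 0 < Real.exp (K * mass v (id a)) / K := by positivity
  linarith

/-- Conjugated by the weight `exp (K ∫_{-∞}^x v)`, the Volterra operator with coefficient `c`,
`|c| = v`, is `1/K`-Lipschitz on bounded continuous functions. -/
theorem exists_weighted_volterra (hμ : μ.re ≤ 0) {K : ℝ≥0} (hK : 0 < K) (hc : Continuous c)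
    (hv : Continuous v) (hvi : Integrable v) (hcv : ∀ x, ‖c x‖ = v x) :
    ∃ Φ : (ℝ →ᵇ ℂ) → (ℝ →ᵇ ℂ), LipschitzWith K⁻¹ Φ ∧
      ∀ f x, Φ f x = (Real.exp (-(K * mass v x)) : ℝ) *
        volterra μ (fun y => c y * ((Real.exp (K * mass v y) : ℝ) * f y)) x := by
  have hK' : (0:ℝ) < K := hK
  have hv0 : ∀ x, 0 ≤ v x := fun x => hcv x ▸ norm_nonneg _
  have hm := continuous_of_forall_hasDerivAt (hasDerivAt_mass hv hvi)
  set k : (ℝ →ᵇ ℂ) → ℝ → ℂ := fun f y => c y * ((Real.exp (K * mass v y) : ℝ) * f y) with hk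
  have hkc : ∀ f, Continuous (k f) := fun f => by
    have := f.continuous
    simp only [hk]; fun_prop
  have hkn : ∀ f y, ‖k f y‖ ≤ ‖f‖ * (Real.exp (K * mass v y) * v y) := by
    intro f y
    simp only [hk, norm_mul, hcv, Complex.norm_real, Real.norm_of_nonneg (Real.exp_pos _).le]
    have := f.norm_coe_le_norm y
    have h2 : 0 ≤ Real.exp (K * mass v y) * v y := mul_nonneg (Real.exp_pos _).le (hv0 y)
    nlinarith
  have hki : ∀ f, Integrable (k f) := fun f =>
    ((integrable_exp_mass_mul hK' hv hvi hv0).const_mul ‖f‖).mono'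
      (hkc f).aestronglyMeasurable (Eventually.of_forall (hkn f))
  have hbound : ∀ f x, ‖((Real.exp (-(K * mass v x)) : ℝ) : ℂ) * volterra μ (k f) x‖
      ≤ (K:ℝ)⁻¹ * ‖f‖ := by
    intro f x
    rw [norm_mul, Complex.norm_real, Real.norm_of_nonneg (Real.exp_pos _).le]
    have h1 : ‖volterra μ (k f) x‖ ≤ ‖f‖ * (Real.exp (K * mass v x) / K) := by
      refine (norm_volterra_le hμ (hki f) x).trans ?_
      refine (setIntegral_mono (hki f).norm.integrableOn
        ((integrable_exp_mass_mul hK' hv hvi hv0).const_mul ‖f‖).integrableOn (hkn f)).trans ?_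
      rw [integral_const_mul]
      exact mul_le_mul_of_nonneg_left (integral_exp_mass_le hK' hv hvi hv0 x) (norm_nonneg _)
    calc Real.exp (-(K * mass v x)) * ‖volterra μ (k f) x‖
        ≤ Real.exp (-(K * mass v x)) * (‖f‖ * (Real.exp (K * mass v x) / K)) := by gcongr
      _ = (Real.exp (-(K * mass v x)) * Real.exp (K * mass v x)) * ((K:ℝ)⁻¹ * ‖f‖) := by
          rw [div_eq_mul_inv]; ring
      _ = (K:ℝ)⁻¹ * ‖f‖ := by rw [← Real.exp_add]; simp
  have hcont : ∀ f, Continuous fun x : ℝ =>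
      ((Real.exp (-(K * mass v x)) : ℝ) : ℂ) * volterra μ (k f) x := by
    intro f
    have := continuous_of_forall_hasDerivAt (hasDerivAt_volterra hμ (hkc f) (hki f))
    fun_prop
  refine ⟨fun f => BoundedContinuousFunction.ofNormedAddCommGroup _ (hcont f) _ (hbound f),
    LipschitzWith.of_dist_le_mul fun f g => ?_, fun f x => rfl⟩
  rw [BoundedContinuousFunction.dist_le (by positivity)]
  intro x
  have h := hbound (f - g) x
  have hkfg : k (f - g) = fun y => k f y - k g y := by
    funext y; simp only [hk, BoundedContinuousFunction.coe_sub, Pi.sub_apply]; ring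
  rw [hkfg, volterra_sub hμ (hkc f) (hki f) (hkc g) (hki g), mul_sub] at h
  rw [dist_eq_norm, dist_eq_norm, NNReal.coe_inv]
  exact h

end Volterra

/-- The Volterra system for the Jost function has a bounded continuous solution: in the weight with
`K = |lam| + 1`, eliminating `g` leaves a contraction with constant `(|lam| / K)²` for `f`. -/
theorem exists_volterra_system {U : ℝ → ℂ} (hU : Continuous U) (hUi : Integrable U) (lam : ℂ)
    {μ : ℂ} (hμ : μ.re ≤ 0) :
    ∃ f g : ℝ →ᵇ ℂ, (∀ x, f x = 1 + lam * volterra 0 (fun y => U y * g y) x) ∧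
      ∀ x, g x = -lam * volterra μ (fun y => conj (U y) * f y) x := by
  set v : ℝ → ℝ := fun x => ‖U x‖ with hv
  have hvc : Continuous v := hU.norm
  have hvi : Integrable v := hUi.norm
  have hv0 : ∀ x, 0 ≤ v x := fun x => norm_nonneg _
  have hm := continuous_of_forall_hasDerivAt (hasDerivAt_mass hvc hvi)
  set K : ℝ≥0 := ‖lam‖₊ + 1 with hK
  have hK0 : 0 < K := by positivity
  obtain ⟨Φ, hΦ, hΦe⟩ := exists_weighted_volterra (μ := 0) (by simp) hK0 hU hvc hvi
    (fun x => rfl)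
  obtain ⟨Ψ, hΨ, hΨe⟩ := exists_weighted_volterra (c := fun x => conj (U x)) hμ hK0
    (by fun_prop) hvc hvi (fun x => by simp [hv])
  have hK' : (0:ℝ) < K := hK0
  let e : ℝ →ᵇ ℂ := BoundedContinuousFunction.ofNormedAddCommGroup
    (fun x => ((Real.exp (-(K * mass v x)) : ℝ) : ℂ)) (by fun_prop) 1 (fun x => by
      rw [Complex.norm_real, Real.norm_of_nonneg (Real.exp_pos _).le, Real.exp_le_one_iff]
      have := mass_nonneg hv0 x
      have : 0 ≤ K * mass v x := mul_nonneg hK'.le this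
      linarith)
  let w : ℝ →ᵇ ℂ := BoundedContinuousFunction.ofNormedAddCommGroup
    (fun x => ((Real.exp (K * mass v x) : ℝ) : ℂ)) (by fun_prop) (Real.exp (K * ∫ t, v t))
    (fun x => by
      rw [Complex.norm_real, Real.norm_of_nonneg (Real.exp_pos _).le]
      have := mass_le hvi hv0 x
      gcongr)
  have hew : ∀ x, ((Real.exp (K * mass v x) : ℝ) : ℂ) * ((Real.exp (-(K * mass v x)) : ℝ) : ℂ)
      = 1 := by
    intro x
    rw [← Complex.ofReal_mul, ← Real.exp_add]; simp
  let T : (ℝ →ᵇ ℂ) → (ℝ →ᵇ ℂ) := fun f => e + lam • Φ (-lam • Ψ f)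
  have hT : ContractingWith (‖lam‖₊ * K⁻¹ * (‖lam‖₊ * K⁻¹)) T := by
    have hlt : ‖lam‖₊ * K⁻¹ < 1 := by
      rw [← div_eq_mul_inv, div_lt_one hK0, hK]; exact lt_add_one _
    refine ⟨mul_lt_one_of_nonneg_of_lt_one_left zero_le hlt hlt.le, ?_⟩
    refine LipschitzWith.of_dist_le_mul fun f g => ?_
    have h1 := hΦ.dist_le_mul (-lam • Ψ f) (-lam • Ψ g)
    have h2 := hΨ.dist_le_mul f g
    have h3 : dist (-lam • Ψ f) (-lam • Ψ g) ≤ ‖lam‖ * dist (Ψ f) (Ψ g) := by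
      rw [dist_eq_norm, dist_eq_norm, ← smul_sub]
      simpa using norm_smul_le (-lam) (Ψ f - Ψ g)
    have h4 : dist (T f) (T g) ≤ ‖lam‖ * dist (Φ (-lam • Ψ f)) (Φ (-lam • Ψ g)) := by
      simp only [T]
      rw [dist_add_left, dist_eq_norm, dist_eq_norm, ← smul_sub]
      exact norm_smul_le _ _
    push_cast at h1 h2 ⊢
    calc dist (T f) (T g) ≤ ‖lam‖ * ((K:ℝ)⁻¹ * (‖lam‖ * ((K:ℝ)⁻¹ * dist f g))) := by
          refine h4.trans ?_
          gcongr
          refine h1.trans ?_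
          gcongr
          refine h3.trans ?_
          gcongr
      _ = _ := by ring
  set F := ContractingWith.fixedPoint T hT with hF
  have hfix : T F = F := hT.fixedPoint_isFixedPt
  refine ⟨w * F, w * (-lam • Ψ F), fun x => ?_, fun x => ?_⟩
  · have h : (e + lam • Φ (-lam • Ψ F)) x = F x := DFunLike.congr_fun hfix x
    have hx : (w * F) x = ((Real.exp (K * mass v x) : ℝ) : ℂ) * F x := rfl
    have hex : e x = ((Real.exp (-(K * mass v x)) : ℝ) : ℂ) := rfl
    rw [BoundedContinuousFunction.add_apply, BoundedContinuousFunction.smul_apply, hΦe, hex,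
      smul_eq_mul] at h
    rw [hx, ← h]
    have hint : (fun y => U y * (w * (-lam • Ψ F)) y) =
        fun y => U y * (((Real.exp (K * mass v y) : ℝ) : ℂ) * (-lam • Ψ F) y) := rfl
    rw [hint]
    linear_combination (1 + lam * volterra 0 (fun y =>
      U y * (((Real.exp (K * mass v y) : ℝ) : ℂ) * (-lam • Ψ F) y)) x) * hew x
  · have hx : (w * (-lam • Ψ F)) x = ((Real.exp (K * mass v x) : ℝ) : ℂ) * (-lam * Ψ F x) := rfl
    rw [hx, hΨe]
    have hint : (fun y => conj (U y) * (w * F) y) =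
        fun y => conj (U y) * (((Real.exp (K * mass v y) : ℝ) : ℂ) * F y) := rfl
    rw [hint]
    linear_combination (-lam * volterra μ (fun y =>
      conj (U y) * (((Real.exp (K * mass v y) : ℝ) : ℂ) * F y)) x) * hew x

/-! ### Solutions of the Kaup–Newell problem and the Jost function -/

/-- The right-hand side of the Kaup–Newell problem where the potential has the value `z`. -/
noncomputable def knField (lam z : ℂ) (y : Fin 2 → ℂ) : Fin 2 → ℂ :=
  ((-Complex.I * lam ^ 2) • sigma3 + lam • Q z) *ᵥ y

theorem knField_zero (lam z : ℂ) (y : Fin 2 → ℂ) :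
    knField lam z y 0 = -Complex.I * lam ^ 2 * y 0 + lam * z * y 1 := by
  simp [knField, sigma3, Q, Matrix.mulVec, dotProduct, Fin.sum_univ_two]

theorem knField_one (lam z : ℂ) (y : Fin 2 → ℂ) :
    knField lam z y 1 = Complex.I * lam ^ 2 * y 1 - lam * conj z * y 0 := by
  simp [knField, sigma3, Q, Matrix.mulVec, dotProduct, Fin.sum_univ_two]
  ring

section Solutions

variable {U : ℝ → ℂ} {lam : ℂ} {ψ ψ' : ℝ → Fin 2 → ℂ}

theorem continuous_knField (hU : Continuous U) (hψ : Continuous ψ) :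
    Continuous fun t => knField lam (U t) (ψ t) := by
  refine continuous_pi fun i => ?_
  have h0 : Continuous fun t => ψ t 0 := (continuous_apply 0).comp hψ
  have h1 : Continuous fun t => ψ t 1 := (continuous_apply 1).comp hψ
  fin_cases i
  · simp only [Fin.zero_eta, knField_zero]; fun_prop
  · simp only [Fin.mk_one, knField_one]; fun_prop

theorem isKNSolution_iff (hU : Continuous U) :
    IsKNSolution U lam ψ ↔ ∀ x, HasDerivAt ψ (knField lam (U x) (ψ x)) x := by
  constructor
  · rintro ⟨hc, h⟩ x
    have hk := continuous_knField (lam := lam) hU hc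
    have he : ψ = fun x => ψ 0 + ∫ t in (0:ℝ)..x, knField lam (U t) (ψ t) := by
      funext x
      have := h 0 x
      simp only [knField]
      rw [← this]; abel
    have := (intervalIntegral.integral_hasDerivAt_right (hk.intervalIntegrable 0 x)
      (hk.stronglyMeasurableAtFilter _ _) hk.continuousAt).const_add (ψ 0)
    rwa [← he] at this
  · intro h
    have hc := continuous_of_forall_hasDerivAt h
    have hk := continuous_knField (lam := lam) hU hc
    exact ⟨hc, fun x y => (intervalIntegral.integral_eq_sub_of_hasDerivAt (fun t _ => h t)
      (hk.intervalIntegrable _ _)).symm⟩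

theorem IsKNSolution.congr_ae {u : ℝ → ℂ} (h : IsKNSolution u lam ψ) (hu : u =ᵐ[volume] U) :
    IsKNSolution U lam ψ :=
  ⟨h.1, fun x y => by
    rw [h.2 x y]
    exact intervalIntegral.integral_congr_ae (hu.mono fun t ht _ => by rw [ht])⟩

theorem hasDerivAt_zero_of_isKNSolution (hU : Continuous U) (h : IsKNSolution U lam ψ) (x : ℝ) :
    HasDerivAt (fun x => ψ x 0) (-Complex.I * lam ^ 2 * ψ x 0 + lam * U x * ψ x 1) x := by
  rw [← knField_zero]
  exact hasDerivAt_pi.1 ((isKNSolution_iff hU).1 h x) 0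

theorem hasDerivAt_one_of_isKNSolution (hU : Continuous U) (h : IsKNSolution U lam ψ) (x : ℝ) :
    HasDerivAt (fun x => ψ x 1) (Complex.I * lam ^ 2 * ψ x 1 - lam * conj (U x) * ψ x 0) x := by
  rw [← knField_one]
  exact hasDerivAt_pi.1 ((isKNSolution_iff hU).1 h x) 1

/-- For bounded `U` the field is uniformly Lipschitz, so solutions agreeing at a point agree. -/
theorem IsKNSolution.eq_of_eq {B : ℝ} (hU : Continuous U) (hB : ∀ x, ‖U x‖ ≤ B)
    (h : IsKNSolution U lam ψ) (h' : IsKNSolution U lam ψ') {x₀ : ℝ} (h0 : ψ x₀ = ψ' x₀) :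
    ψ = ψ' := by
  have hB0 : 0 ≤ B := (norm_nonneg _).trans (hB 0)
  have hlip : ∀ t, LipschitzOnWith (Real.toNNReal (‖lam‖ ^ 2 + ‖lam‖ * B))
      (fun y => knField lam (U t) y) Set.univ := by
    intro t
    rw [lipschitzOnWith_univ]
    refine LipschitzWith.of_dist_le_mul fun y z => ?_
    have hp : 0 ≤ ‖lam‖ ^ 2 + ‖lam‖ * B := by positivity
    rw [Real.coe_toNNReal _ hp, dist_pi_le_iff (by positivity)]
    have d0 : ‖y 0 - z 0‖ ≤ dist y z := by rw [← dist_eq_norm]; exact dist_le_pi_dist y z 0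
    have d1 : ‖y 1 - z 1‖ ≤ dist y z := by rw [← dist_eq_norm]; exact dist_le_pi_dist y z 1
    have hUt := hB t
    intro i
    fin_cases i
    · simp only [Fin.zero_eta, knField_zero, dist_eq_norm]
      calc _ = ‖(-Complex.I * lam ^ 2) * (y 0 - z 0) + lam * U t * (y 1 - z 1)‖ := by
            congr 1; ring
        _ ≤ ‖(-Complex.I * lam ^ 2) * (y 0 - z 0)‖ + ‖lam * U t * (y 1 - z 1)‖ := norm_add_le _ _
        _ = ‖lam‖ ^ 2 * ‖y 0 - z 0‖ + ‖lam‖ * ‖U t‖ * ‖y 1 - z 1‖ := by simp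
        _ ≤ ‖lam‖ ^ 2 * dist y z + ‖lam‖ * B * dist y z := by gcongr
        _ = _ := by rw [dist_eq_norm y z]; ring
    · simp only [Fin.mk_one, knField_one, dist_eq_norm]
      calc _ = ‖(Complex.I * lam ^ 2) * (y 1 - z 1) - lam * conj (U t) * (y 0 - z 0)‖ := by
            congr 1; ring
        _ ≤ ‖(Complex.I * lam ^ 2) * (y 1 - z 1)‖ + ‖lam * conj (U t) * (y 0 - z 0)‖ :=
            norm_sub_le _ _
        _ = ‖lam‖ ^ 2 * ‖y 1 - z 1‖ + ‖lam‖ * ‖U t‖ * ‖y 0 - z 0‖ := by simp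
        _ ≤ ‖lam‖ ^ 2 * dist y z + ‖lam‖ * B * dist y z := by gcongr
        _ = _ := by rw [dist_eq_norm y z]; ring
  exact ODE_solution_unique_univ hlip
    (fun t => ⟨(isKNSolution_iff hU).1 h t, Set.mem_univ _⟩)
    (fun t => ⟨(isKNSolution_iff hU).1 h' t, Set.mem_univ _⟩) h0

theorem isKNSolution_zero : IsKNSolution U lam 0 :=
  ⟨continuous_const, fun x y => by simp⟩

theorem IsKNSolution.smul (hU : Continuous U) (h : IsKNSolution U lam ψ) (c : ℂ) :
    IsKNSolution U lam (fun x => c • ψ x) := by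
  rw [isKNSolution_iff hU] at h ⊢
  intro x
  have := (h x).const_smul c
  rwa [knField, Matrix.mulVec_smul]

/-- The coefficient matrix has trace zero, so the Wronskian of two solutions is constant. -/
theorem IsKNSolution.wronskian_const (hU : Continuous U) (h : IsKNSolution U lam ψ)
    (h' : IsKNSolution U lam ψ') (x y : ℝ) :
    ψ x 0 * ψ' x 1 - ψ x 1 * ψ' x 0 = ψ y 0 * ψ' y 1 - ψ y 1 * ψ' y 0 := by
  have hd : ∀ x, HasDerivAt (fun x => ψ x 0 * ψ' x 1 - ψ x 1 * ψ' x 0) 0 x := by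
    intro x
    convert! ((hasDerivAt_zero_of_isKNSolution hU h x).mul
      (hasDerivAt_one_of_isKNSolution hU h' x)).sub
      ((hasDerivAt_one_of_isKNSolution hU h x).mul
      (hasDerivAt_zero_of_isKNSolution hU h' x)) using 1
    ring
  exact is_const_of_deriv_eq_zero (fun x => (hd x).differentiableAt) (fun x => (hd x).deriv) x y

end Solutions

section Jost

variable {U : ℝ → ℂ} {lam : ℂ} {φ φ' : ℝ → Fin 2 → ℂ}

theorem expFactor_ne_zero (lam : ℂ) (x : ℝ) : expFactor lam x ≠ 0 := Complex.exp_ne_zero _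

theorem norm_expFactor (lam : ℂ) (x : ℝ) :
    ‖expFactor lam x‖ = Real.exp (2 * lam.re * lam.im * x) := by
  rw [expFactor, Complex.norm_exp]
  congr 1
  simp [pow_two]
  ring

theorem hasDerivAt_expFactor (lam : ℂ) (x : ℝ) :
    HasDerivAt (expFactor lam) (-Complex.I * lam ^ 2 * expFactor lam x) x := by
  have := ((hasDerivAt_id (x : ℂ)).const_mul (-Complex.I * lam ^ 2)).cexp.comp_ofReal
  simp only [id, mul_one] at this
  convert! this using 1
  rw [mul_comm]; rfl

theorem tendsto_expFactor (hlam : 0 < lam.re * lam.im) :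
    Tendsto (expFactor lam) atBot (𝓝 0) := by
  rw [tendsto_zero_iff_norm_tendsto_zero]
  simp only [norm_expFactor]
  refine Real.tendsto_exp_atBot.comp ?_
  exact tendsto_id.const_mul_atBot (by linarith : 0 < 2 * lam.re * lam.im)

theorem IsJostMinus.congr_ae {u : ℝ → ℂ} (h : IsJostMinus u lam φ) (hu : u =ᵐ[volume] U) :
    IsJostMinus U lam φ :=
  ⟨h.1.congr_ae hu, h.2⟩

theorem IsJostMinus.tendsto_zero (h : IsJostMinus U lam φ) :
    Tendsto (fun x => φ x 0) atBot (𝓝 1) := by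
  simpa using tendsto_pi_nhds.1 h.2.2 0

theorem IsJostMinus.tendsto_one (h : IsJostMinus U lam φ) :
    Tendsto (fun x => φ x 1) atBot (𝓝 0) := by
  simpa using tendsto_pi_nhds.1 h.2.2 1

/-- In the variable `φ = e^{i lam² x} ψ` the problem reads `φ₁' = lam U φ₂` and
`φ₂' = 2i lam² φ₂ - lam Ū φ₁`, where `re (2i lam²) = -4 (re lam) (im lam) < 0`. -/
theorem exists_isJostMinus (hU : Continuous U) (hUi : Integrable U) (hlam : 0 < lam.re * lam.im) :
    ∃ φ, IsJostMinus U lam φ := by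
  set μ : ℂ := 2 * Complex.I * lam ^ 2 with hμ
  have hμre : μ.re ≤ 0 := by
    have : μ.re = -(4 * (lam.re * lam.im)) := by
      simp [hμ, pow_two]; ring
    rw [this]; linarith
  obtain ⟨f, g, hf, hg⟩ := exists_volterra_system hU hUi lam hμre
  have hfc := f.continuous
  have hgc := g.continuous
  have hi1 : Integrable fun y => U y * g y :=
    hUi.mul_bdd (c := ‖g‖) hgc.aestronglyMeasurable (Eventually.of_forall g.norm_coe_le_norm)
  have hi2 : Integrable fun y => conj (U y) * f y :=
    (Complex.conjLIE.toContinuousLinearEquiv.integrable_comp_iff.2 hUi).mul_bdd (c := ‖f‖)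
      hfc.aestronglyMeasurable (Eventually.of_forall f.norm_coe_le_norm)
  have hfd : ∀ x, HasDerivAt f (lam * (U x * g x)) x := by
    intro x
    have := ((hasDerivAt_volterra (μ := 0) (by simp)
      (by fun_prop : Continuous fun y => U y * g y) hi1 x).const_mul lam).const_add 1
    rw [show (f : ℝ → ℂ) = fun x => 1 + lam * volterra 0 (fun y => U y * g y) x from funext hf]
    simpa using this
  have hgd : ∀ x, HasDerivAt g (-lam * (conj (U x) * f x) + μ * g x) x := by
    intro x
    have := (hasDerivAt_volterra hμre
      (by fun_prop : Continuous fun y => conj (U y) * f y) hi2 x).const_mul (-lam)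
    rw [hg x]
    rw [show (g : ℝ → ℂ) = fun x => -lam * volterra μ (fun y => conj (U y) * f y) x from
      funext hg]
    convert! this using 1
    ring
  refine ⟨fun x => ![f x, g x], ?_, ⟨max ‖f‖ ‖g‖, fun x => ?_⟩, ?_⟩
  · rw [isKNSolution_iff hU]
    intro x
    rw [hasDerivAt_pi]
    intro i
    have hE := hasDerivAt_expFactor lam x
    fin_cases i
    · simp only [Fin.zero_eta, knField_zero]
      simp only [Pi.smul_apply, smul_eq_mul, Matrix.cons_val_zero, Matrix.cons_val_one]
      convert! hE.mul (hfd x) using 1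
      ring
    · simp only [Fin.mk_one, knField_one]
      simp only [Pi.smul_apply, smul_eq_mul, Matrix.cons_val_zero, Matrix.cons_val_one]
      convert! hE.mul (hgd x) using 1
      rw [hμ]; ring
  · rw [pi_norm_le_iff_of_nonneg (le_max_of_le_left (norm_nonneg _))]
    intro i
    fin_cases i
    · exact (f.norm_coe_le_norm x).trans (le_max_left _ _)
    · exact (g.norm_coe_le_norm x).trans (le_max_right _ _)
  · rw [tendsto_pi_nhds]
    intro i
    fin_cases i
    · have := ((tendsto_volterra_atBot (μ := 0) (by simp) hi1).const_mul lam).const_add 1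
      simp only [mul_zero, add_zero] at this
      exact this.congr fun x => (hf x).symm
    · have := (tendsto_volterra_atBot hμre hi2).const_mul (-lam)
      simp only [mul_zero] at this
      exact this.congr fun x => (hg x).symm

/-- Two Jost functions have vanishing Wronskian, hence are proportional, and the factor is `1` by
the normalization at `-∞`. -/
theorem IsJostMinus.unique {B : ℝ} (hU : Continuous U) (hB : ∀ x, ‖U x‖ ≤ B)
    (hlam : 0 < lam.re * lam.im) (h : IsJostMinus U lam φ) (h' : IsJostMinus U lam φ') :
    φ = φ' := by
  have hW : ∀ x, φ x 0 * φ' x 1 - φ x 1 * φ' x 0 = 0 := by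
    intro x
    have hlim : Tendsto (fun y => expFactor lam y * expFactor lam y *
        (φ y 0 * φ' y 1 - φ y 1 * φ' y 0)) atBot (𝓝 (0 * 0 * (1 * 0 - 0 * 1))) :=
      ((tendsto_expFactor hlam).mul (tendsto_expFactor hlam)).mul
        ((h.tendsto_zero.mul h'.tendsto_one).sub (h.tendsto_one.mul h'.tendsto_zero))
    have hconst : ∀ y, expFactor lam y * expFactor lam y * (φ y 0 * φ' y 1 - φ y 1 * φ' y 0)
        = expFactor lam x * expFactor lam x * (φ x 0 * φ' x 1 - φ x 1 * φ' x 0) := by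
      intro y
      have := h.1.wronskian_const hU h'.1 y x
      simp only [Pi.smul_apply, smul_eq_mul] at this
      linear_combination this
    simp only [hconst] at hlim
    have h0 := tendsto_nhds_unique tendsto_const_nhds hlim
    have hE := expFactor_ne_zero lam x
    simpa [hE] using h0
  obtain ⟨x₀, hx₀⟩ := (h.tendsto_zero.eventually_ne one_ne_zero).exists
  set c := φ' x₀ 0 / φ x₀ 0 with hc
  have heq : (fun x => c • expFactor lam x • φ x) = fun x => expFactor lam x • φ' x := by
    refine (h.1.smul hU c).eq_of_eq hU hB h'.1 (x₀ := x₀) ?_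
    have hv : c • φ x₀ = φ' x₀ := by
      funext i
      fin_cases i
      · simp [hc, hx₀]
      · have := hW x₀
        simp only [Fin.mk_one, Pi.smul_apply, smul_eq_mul, hc]
        field_simp
        linear_combination -this
    rw [smul_comm, hv]
  have heq' : ∀ x, c • φ x = φ' x := by
    intro x
    have := congrFun heq x
    rw [smul_comm] at this
    exact smul_right_injective _ (expFactor_ne_zero lam x) this
  have hc1 : c = 1 := by
    have h1 : Tendsto (fun x => c * φ x 0) atBot (𝓝 (c * 1)) := h.tendsto_zero.const_mul c
    have h2 : (fun x => c * φ x 0) = fun x => φ' x 0 := funext fun x => by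
      rw [← heq' x]; rfl
    rw [h2] at h1
    simpa using tendsto_nhds_unique h1 h'.tendsto_zero
  funext x
  rw [← heq' x, hc1, one_smul]

/-- A Jost function with a zero would vanish identically, against its limit at `-∞`. -/
theorem IsJostMinus.ne_zero {B : ℝ} (hU : Continuous U) (hB : ∀ x, ‖U x‖ ≤ B)
    (h : IsJostMinus U lam φ) (x : ℝ) : φ x ≠ 0 := by
  intro hx
  have hz := h.1.eq_of_eq hU hB isKNSolution_zero (x₀ := x) (by simp [hx])
  obtain ⟨y, hy⟩ := (h.tendsto_zero.eventually_ne one_ne_zero).exists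
  have := congrFun (congrFun hz y) 0
  simp only [Pi.smul_apply, smul_eq_mul, Pi.zero_apply, mul_eq_zero] at this
  exact this.elim (expFactor_ne_zero lam y) hy

end Jost

/-! ### Bounded and decaying function classes -/

/-- Bounded continuous functions. -/
def IsBC (f : ℝ → ℂ) : Prop := Continuous f ∧ ∃ C : ℝ, ∀ x, ‖f x‖ ≤ C

/-- Bounded `C¹` functions with bounded derivative. -/
def IsBC1 (f : ℝ → ℂ) : Prop := ∃ f' : ℝ → ℂ, (∀ x, HasDerivAt f (f' x) x) ∧ IsBC f ∧ IsBC f'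

/-- Bounded `C²` functions with bounded derivatives. -/
def IsBC2 (f : ℝ → ℂ) : Prop := ∃ f' : ℝ → ℂ, (∀ x, HasDerivAt f (f' x) x) ∧ IsBC f ∧ IsBC1 f'

/-- Bounded continuous functions in `L^{2,1}`. -/
def IsDecay (f : ℝ → ℂ) : Prop := IsBC f ∧ MemL21 f

/-- `C¹` functions that are bounded and in `L^{2,1}` together with their derivative. -/
def IsDecay1 (f : ℝ → ℂ) : Prop :=
  ∃ f' : ℝ → ℂ, (∀ x, HasDerivAt f (f' x) x) ∧ IsDecay f ∧ IsDecay f'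

/-- `C¹` functions that are bounded and in `L^{2,1}` together with their derivative, the derivative
being locally absolutely continuous with derivative in `L²`. These are the continuously
differentiable representatives of the elements of `H² ∩ H^{1,1}`. -/
def IsDecay2 (f : ℝ → ℂ) : Prop :=
  ∃ f' : ℝ → ℂ, (∀ x, HasDerivAt f (f' x) x) ∧ IsDecay f ∧ IsDecay f' ∧
    ∃ g : ℝ → ℂ, HasIntDeriv f' g ∧ MemLp g 2 volume

section Classes

variable {f g : ℝ → ℂ}

theorem hasDerivAt_conj {f' : ℂ} {x : ℝ} (h : HasDerivAt f f' x) :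
    HasDerivAt (fun x => conj (f x)) (conj f') x :=
  (Complex.conjCLE : ℂ →L[ℝ] ℂ).hasFDerivAt.comp_hasDerivAt x h

theorem isBC_const (c : ℂ) : IsBC fun _ => c := ⟨continuous_const, ‖c‖, fun _ => le_rfl⟩

theorem IsBC.add (hf : IsBC f) (hg : IsBC g) : IsBC fun x => f x + g x := by
  obtain ⟨hf, C, hC⟩ := hf
  obtain ⟨hg, D, hD⟩ := hg
  exact ⟨hf.add hg, C + D, fun x => (norm_add_le _ _).trans (add_le_add (hC x) (hD x))⟩

theorem IsBC.mul (hf : IsBC f) (hg : IsBC g) : IsBC fun x => f x * g x := by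
  obtain ⟨hf, C, hC⟩ := hf
  obtain ⟨hg, D, hD⟩ := hg
  refine ⟨hf.mul hg, C * D, fun x => ?_⟩
  rw [norm_mul]
  exact mul_le_mul (hC x) (hD x) (norm_nonneg _) ((norm_nonneg _).trans (hC x))

theorem IsBC.conj (hf : IsBC f) : IsBC fun x => conj (f x) := by
  obtain ⟨hf, C, hC⟩ := hf
  exact ⟨by fun_prop, C, fun x => by simpa using hC x⟩

theorem isBC1_const (c : ℂ) : IsBC1 fun _ => c :=
  ⟨fun _ => 0, fun x => hasDerivAt_const x c, isBC_const c, isBC_const 0⟩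

theorem IsBC1.add (hf : IsBC1 f) (hg : IsBC1 g) : IsBC1 fun x => f x + g x := by
  obtain ⟨f', h1, h2, h3⟩ := hf
  obtain ⟨g', k1, k2, k3⟩ := hg
  exact ⟨_, fun x => (h1 x).add (k1 x), h2.add k2, h3.add k3⟩

theorem IsBC1.mul (hf : IsBC1 f) (hg : IsBC1 g) : IsBC1 fun x => f x * g x := by
  obtain ⟨f', h1, h2, h3⟩ := hf
  obtain ⟨g', k1, k2, k3⟩ := hg
  exact ⟨_, fun x => (h1 x).mul (k1 x), h2.mul k2, (h3.mul k2).add (h2.mul k3)⟩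

theorem IsBC1.conj (hf : IsBC1 f) : IsBC1 fun x => conj (f x) := by
  obtain ⟨f', h1, h2, h3⟩ := hf
  exact ⟨_, fun x => hasDerivAt_conj (h1 x), h2.conj, h3.conj⟩

theorem IsBC2.isBC1 (hf : IsBC2 f) : IsBC1 f := by
  obtain ⟨f', h1, h2, h3⟩ := hf
  exact ⟨f', h1, h2, h3.choose_spec.2.1⟩

theorem isBC2_const (c : ℂ) : IsBC2 fun _ => c :=
  ⟨fun _ => 0, fun x => hasDerivAt_const x c, isBC_const c, isBC1_const 0⟩

theorem IsBC2.add (hf : IsBC2 f) (hg : IsBC2 g) : IsBC2 fun x => f x + g x := by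
  obtain ⟨f', h1, h2, h3⟩ := hf
  obtain ⟨g', k1, k2, k3⟩ := hg
  exact ⟨_, fun x => (h1 x).add (k1 x), h2.add k2, h3.add k3⟩

theorem IsBC2.mul (hf : IsBC2 f) (hg : IsBC2 g) : IsBC2 fun x => f x * g x := by
  have hf1 := hf.isBC1
  have hg1 := hg.isBC1
  obtain ⟨f', h1, h2, h3⟩ := hf
  obtain ⟨g', k1, k2, k3⟩ := hg
  exact ⟨_, fun x => (h1 x).mul (k1 x), h2.mul k2, (h3.mul hg1).add (hf1.mul k3)⟩

theorem IsBC.aestronglyMeasurable (hf : IsBC f) : AEStronglyMeasurable f volume :=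
  hf.1.aestronglyMeasurable

theorem MemL21.memLp (hf : MemL21 f) (hm : AEStronglyMeasurable f volume) : MemLp f 2 volume := by
  refine hf.mono hm (Eventually.of_forall fun x => ?_)
  rw [norm_smul, Real.norm_of_nonneg (Real.sqrt_nonneg _)]
  exact le_mul_of_one_le_left (norm_nonneg _) (Real.one_le_sqrt.2 (by nlinarith [sq_nonneg x]))

theorem MemL21.congr_ae (hf : MemL21 f) (h : f =ᵐ[volume] g) : MemL21 g :=
  MemLp.ae_eq (h.mono fun x hx => by simp only [hx]) hf

theorem norm_sqrt_smul_sq (x : ℝ) (z : ℂ) :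
    ‖Real.sqrt (1 + x ^ 2) • z‖ ^ 2 = (1 + x ^ 2) * ‖z‖ ^ 2 := by
  rw [norm_smul, Real.norm_of_nonneg (Real.sqrt_nonneg _), mul_pow, Real.sq_sqrt (by positivity)]

theorem memL21_iff (hf : Continuous f) :
    MemL21 f ↔ Integrable fun x => (1 + x ^ 2) * ‖f x‖ ^ 2 := by
  rw [MemL21, memLp_two_iff_integrable_sq_norm (Continuous.aestronglyMeasurable (by fun_prop))]
  simp only [norm_sqrt_smul_sq]

/-- `L^{2,1} ⊂ L¹`, from `2 |f| ≤ (1 + x²)⁻¹ + (1 + x²) |f|²`. -/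
theorem integrable_of_memL21 (hf : Continuous f) (h : MemL21 f) : Integrable f := by
  have h1 := (memL21_iff hf).1 h
  refine ((integrable_inv_one_add_sq.add h1).div_const 2).mono' hf.aestronglyMeasurable
    (Eventually.of_forall fun x => ?_)
  have hp : 0 < 1 + x ^ 2 := by positivity
  have h2 : 0 ≤ (1 - (1 + x ^ 2) * ‖f x‖) ^ 2 / (1 + x ^ 2) := by positivity
  have h3 : (1 - (1 + x ^ 2) * ‖f x‖) ^ 2 / (1 + x ^ 2)
      = (1 + x ^ 2)⁻¹ + (1 + x ^ 2) * ‖f x‖ ^ 2 - 2 * ‖f x‖ := by field_simp; ring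
  simp only [Pi.add_apply]
  linarith

theorem IsDecay.add (hf : IsDecay f) (hg : IsDecay g) : IsDecay fun x => f x + g x := by
  refine ⟨hf.1.add hg.1, ?_⟩
  have := MemLp.add hf.2 hg.2
  unfold MemL21
  simp only [smul_add]
  exact this

theorem IsBC.mul_isDecay (hf : IsBC f) (hg : IsDecay g) : IsDecay fun x => f x * g x := by
  refine ⟨hf.mul hg.1, ?_⟩
  have hfc := hf.1
  have hgc := hg.1.1
  obtain ⟨C, hC⟩ := hf.2
  refine MemLp.of_le_mul (c := C) hg.2 (Continuous.aestronglyMeasurable (by fun_prop))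
    (Eventually.of_forall fun x => ?_)
  rw [norm_smul, norm_smul, norm_mul]
  have h1 := hC x
  have h2 : 0 ≤ ‖Real.sqrt (1 + x ^ 2)‖ * ‖g x‖ := by positivity
  nlinarith

theorem IsDecay.conj (hf : IsDecay f) : IsDecay fun x => conj (f x) := by
  refine ⟨hf.1.conj, ?_⟩
  rw [memL21_iff hf.1.conj.1]
  simpa using (memL21_iff hf.1.1).1 hf.2

theorem IsDecay1.isBC1 (hf : IsDecay1 f) : IsBC1 f := by
  obtain ⟨f', h1, h2, h3⟩ := hf
  exact ⟨f', h1, h2.1, h3.1⟩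

theorem IsDecay1.isDecay (hf : IsDecay1 f) : IsDecay f := by
  obtain ⟨f', h1, h2, h3⟩ := hf
  exact h2

theorem IsDecay1.add (hf : IsDecay1 f) (hg : IsDecay1 g) : IsDecay1 fun x => f x + g x := by
  obtain ⟨f', h1, h2, h3⟩ := hf
  obtain ⟨g', k1, k2, k3⟩ := hg
  exact ⟨_, fun x => (h1 x).add (k1 x), h2.add k2, h3.add k3⟩

theorem IsBC1.mul_isDecay1 (hf : IsBC1 f) (hg : IsDecay1 g) : IsDecay1 fun x => f x * g x := by
  obtain ⟨f', h1, h2, h3⟩ := hf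
  obtain ⟨g', k1, k2, k3⟩ := hg
  exact ⟨_, fun x => (h1 x).mul (k1 x), h2.mul_isDecay k2,
    (h3.mul_isDecay k2).add (h2.mul_isDecay k3)⟩

theorem IsDecay1.conj (hf : IsDecay1 f) : IsDecay1 fun x => conj (f x) := by
  obtain ⟨f', h1, h2, h3⟩ := hf
  exact ⟨_, fun x => hasDerivAt_conj (h1 x), h2.conj, h3.conj⟩

theorem IsDecay2.isDecay1 (hf : IsDecay2 f) : IsDecay1 f := by
  obtain ⟨f', h1, h2, h3, -⟩ := hf
  exact ⟨f', h1, h2, h3⟩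

theorem IsDecay1.exists_hasIntDeriv (hf : IsDecay1 f) :
    ∃ g : ℝ → ℂ, HasIntDeriv f g ∧ MemLp g 2 volume := by
  obtain ⟨f', h1, h2, h3⟩ := hf
  exact ⟨f', HasIntDeriv.of_hasDerivAt h1 h3.1.1, h3.2.memLp h3.1.aestronglyMeasurable⟩

theorem isDecay2_of_hasDerivAt {f' : ℝ → ℂ} (h : ∀ x, HasDerivAt f (f' x) x) (hf : IsDecay f)
    (hf' : IsDecay1 f') : IsDecay2 f :=
  ⟨f', h, hf, hf'.isDecay, hf'.exists_hasIntDeriv⟩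

theorem IsDecay2.add (hf : IsDecay2 f) (hg : IsDecay2 g) : IsDecay2 fun x => f x + g x := by
  obtain ⟨f', h1, h2, h3, f'', h4, h5⟩ := hf
  obtain ⟨g', k1, k2, k3, g'', k4, k5⟩ := hg
  exact ⟨_, fun x => (h1 x).add (k1 x), h2.add k2, h3.add k3, _, h4.add k4, h5.add k5⟩

theorem IsBC2.mul_isDecay2 (hf : IsBC2 f) (hg : IsDecay2 g) : IsDecay2 fun x => f x * g x := by
  have hg1 := hg.isDecay1
  have hf1 := hf.isBC1
  obtain ⟨f', h1, h2, h3⟩ := hf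
  obtain ⟨g', k1, k2, k3, g'', k4, k5⟩ := hg
  have hA := h3.mul_isDecay1 hg1
  obtain ⟨a, ha, ha2⟩ := hA.exists_hasIntDeriv
  obtain ⟨f₁, e1, -, e3⟩ := hf1
  obtain rfl : f₁ = f' := funext fun x => (e1 x).unique (h1 x)
  refine ⟨_, fun x => (h1 x).mul (k1 x), h2.mul_isDecay k2,
    hA.isDecay.add (h2.mul_isDecay k3), _, ha.add (HasIntDeriv.mul h1 e3.1 k4), ha2.add ?_⟩
  refine ((e3.mul_isDecay k3).2.memLp (e3.mul k3.1).aestronglyMeasurable).add ?_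
  obtain ⟨C, hC⟩ := h2.2
  refine MemLp.of_le_mul (c := C) k5 (h2.aestronglyMeasurable.mul k5.1)
    (Eventually.of_forall fun x => ?_)
  rw [norm_mul]
  exact mul_le_mul_of_nonneg_right (hC x) (norm_nonneg _)

/-- The embedding `H¹ ⊂ L^∞`: average `|f x| ≤ |f y| + ∫ |g|` over `y ∈ [x, x + 1]`, using
`t ≤ (1 + t²) / 2`. -/
theorem HasIntDeriv.bounded (h : HasIntDeriv f g) (hf : MemLp f 2 volume)
    (hg : MemLp g 2 volume) : ∃ C : ℝ, ∀ x, ‖f x‖ ≤ C := by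
  have hf2 := (memLp_two_iff_integrable_sq_norm hf.1).1 hf
  have hg2 := (memLp_two_iff_integrable_sq_norm hg.1).1 hg
  have hfc := h.continuous
  set A := ∫ x, ‖f x‖ ^ 2
  set B := ∫ x, ‖g x‖ ^ 2
  refine ⟨1 + (A + B) / 2, fun x => ?_⟩
  have hgi : ∀ a b, IntervalIntegrable g volume a b :=
    intervalIntegrable_of_locallyIntegrable h.1
  have hg2i : ∀ a b, IntervalIntegrable (fun t => (1 + ‖g t‖ ^ 2) / 2) volume a b := fun a b =>
    ((intervalIntegrable_const).add hg2.intervalIntegrable).div_const 2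
  have hk : ∀ y ∈ Set.Icc x (x + 1), ‖f x‖ ≤ (1 + ‖f y‖ ^ 2) / 2 + (1 + B) / 2 := by
    intro y hy
    have h1 : ‖f y - f x‖ ≤ (1 + B) / 2 := by
      rw [h.2]
      have hle : ∫ t in x..y, ‖g t‖ ≤ ∫ t in x..(x + 1), (1 + ‖g t‖ ^ 2) / 2 := by
        refine (intervalIntegral.integral_mono_on hy.1 (hgi x y).norm (hg2i x y)
          (fun t _ => by nlinarith [sq_nonneg (‖g t‖ - 1)])).trans ?_
        refine intervalIntegral.integral_mono_interval le_rfl hy.1 hy.2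
          (Eventually.of_forall fun t => ?_) (hg2i _ _)
        simp only [Pi.zero_apply]; positivity
      refine (intervalIntegral.norm_integral_le_integral_norm hy.1).trans (hle.trans ?_)
      rw [intervalIntegral.integral_div, intervalIntegral.integral_add intervalIntegrable_const
        hg2.intervalIntegrable]
      have := intervalIntegral_le_integral_of_nonneg hg2 (fun t => by positivity)
        (by linarith : x ≤ x + 1)
      simp only [intervalIntegral.integral_const, add_sub_cancel_left, smul_eq_mul, mul_one]
      linarith
    have h2 : ‖f x‖ ≤ ‖f y‖ + ‖f y - f x‖ := norm_le_insert (f y) (f x)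
    nlinarith [sq_nonneg (‖f y‖ - 1)]
  have hi := intervalIntegral.integral_mono_on (by linarith : x ≤ x + 1)
    (intervalIntegrable_const (c := ‖f x‖))
    (Continuous.intervalIntegrable (by fun_prop) _ _ : IntervalIntegrable
      (fun y => (1 + ‖f y‖ ^ 2) / 2 + (1 + B) / 2) volume x (x + 1)) hk
  rw [intervalIntegral.integral_add (Continuous.intervalIntegrable (by fun_prop) _ _)
    intervalIntegrable_const, intervalIntegral.integral_div,
    intervalIntegral.integral_add intervalIntegrable_const hf2.intervalIntegrable] at hi
  simp only [intervalIntegral.integral_const, add_sub_cancel_left, smul_eq_mul, mul_one,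
    one_mul] at hi
  have := intervalIntegral_le_integral_of_nonneg hf2 (fun t => by positivity)
    (by linarith : x ≤ x + 1)
  linarith

/-- The two weak derivatives of `u`, from `H²` and from `H^{1,1}`, agree almost everywhere, so one
`C¹` representative carries both memberships. -/
theorem exists_isDecay2_representative {u : ℝ → ℂ} (h2 : MemH2 u) (h11 : MemH11 u) :
    ∃ U, u =ᵐ[volume] U ∧ IsDecay2 U := by
  obtain ⟨hu, u₁, u₂, hw1, hw2, hu1, hu2⟩ := h2
  obtain ⟨hd, u₁', hw1', hd1⟩ := h11
  obtain ⟨U₁, hU1, he1⟩ := hw2.exists_hasIntDeriv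
  obtain ⟨U, hU, he⟩ := hw1.exists_hasIntDeriv
  have hUU := hU.congr_ae he1
  obtain ⟨C, hC⟩ := hU.bounded (hu.ae_eq he) hu1
  obtain ⟨C₁, hC₁⟩ := hU1.bounded (hu1.ae_eq he1) hu2
  exact ⟨U, he, U₁, hUU.hasDerivAt hU1.continuous, ⟨⟨hU.continuous, C, hC⟩, hd.congr_ae he⟩,
    ⟨⟨hU1.continuous, C₁, hC₁⟩, hd1.congr_ae ((hw1'.ae_unique hw1).trans he1)⟩, u₂, hU1, hu2⟩

theorem IsDecay2.memH2_memH11 {v V : ℝ → ℂ} (hV : IsDecay2 V) (h : V =ᵐ[volume] v) :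
    MemH2 v ∧ MemH11 v := by
  obtain ⟨V', h1, h2, h3, V'', h4, h5⟩ := hV
  have hw : HasWeakDeriv v V' := ((HasIntDeriv.of_hasDerivAt h1 h3.1.1).hasWeakDeriv).congr_ae h
  exact ⟨⟨(h2.2.memLp h2.1.aestronglyMeasurable).ae_eq h, V', V'', hw, h4.hasWeakDeriv,
    h3.2.memLp h3.1.aestronglyMeasurable, h5⟩, h2.2.congr_ae h, V', hw, h3.2⟩

end Classes

/-! ### Bloch coordinates of a solution -/

/-- The squared length `|y₁|² + |y₂|²`, as a complex number. -/
noncomputable def sqNorm (y : Fin 2 → ℂ) : ℂ := y 0 * conj (y 0) + y 1 * conj (y 1)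

/-- The projective coordinate `p = (|y₁|² - |y₂|²) / |y|²`. -/
noncomputable def polar (y : Fin 2 → ℂ) : ℂ := (y 0 * conj (y 0) - y 1 * conj (y 1)) / sqNorm y

/-- The projective coordinate `q = y₁ ȳ₂ / |y|²`. -/
noncomputable def cross (y : Fin 2 → ℂ) : ℂ := y 0 * conj (y 1) / sqNorm y

/-- The normalized reciprocal `|y|² / d_lam(y, y)`, as a function of `p`. -/
noncomputable def recipForm (lam : ℂ) (y : Fin 2 → ℂ) : ℂ :=
  2 / (lam + conj lam + (lam - conj lam) * polar y)

section Algebra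

variable {lam : ℂ} {y : Fin 2 → ℂ}

theorem sqNorm_eq_ofReal (y : Fin 2 → ℂ) :
    sqNorm y = ((Complex.normSq (y 0) + Complex.normSq (y 1) : ℝ) : ℂ) := by
  simp [sqNorm, Complex.mul_conj]

theorem sqNorm_ne_zero (hy : y ≠ 0) : sqNorm y ≠ 0 := by
  rw [sqNorm_eq_ofReal, Complex.ofReal_ne_zero]
  intro h
  have h0 := Complex.normSq_nonneg (y 0)
  have h1 := Complex.normSq_nonneg (y 1)
  have e0 : Complex.normSq (y 0) = 0 := by linarith
  have e1 : Complex.normSq (y 1) = 0 := by linarith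
  refine hy (funext fun i => ?_)
  fin_cases i
  · exact Complex.normSq_eq_zero.1 e0
  · exact Complex.normSq_eq_zero.1 e1

theorem conj_sqNorm (y : Fin 2 → ℂ) : conj (sqNorm y) = sqNorm y := by
  simp [sqNorm]; ring

theorem conj_polar (y : Fin 2 → ℂ) : conj (polar y) = polar y := by
  rw [polar, map_div₀, conj_sqNorm]
  congr 1
  simp; ring

theorem ofReal_re_polar (y : Fin 2 → ℂ) : ((polar y).re : ℂ) = polar y :=
  Complex.conj_eq_iff_re.1 (conj_polar y)

theorem conj_cross (y : Fin 2 → ℂ) : conj (cross y) = y 1 * conj (y 0) / sqNorm y := by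
  rw [cross, map_div₀, conj_sqNorm]
  congr 1
  simp; ring

theorem four_mul_normSq_cross (hy : y ≠ 0) : 4 * ‖cross y‖ ^ 2 = 1 - (polar y).re ^ 2 := by
  have hN := sqNorm_ne_zero hy
  have h : 4 * (cross y * conj (cross y)) = 1 - polar y ^ 2 := by
    rw [conj_cross, cross, polar]
    field_simp
    rw [sqNorm]; ring
  rw [Complex.mul_conj, Complex.normSq_eq_norm_sq, ← ofReal_re_polar y] at h
  exact_mod_cast h

theorem abs_re_polar_le (hy : y ≠ 0) : |(polar y).re| ≤ 1 := by
  have := four_mul_normSq_cross hy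
  rw [abs_le_one_iff_mul_self_le_one]
  nlinarith [sq_nonneg ‖cross y‖]

/-- Invariance under scaling removes the exponential factor of `η`. -/
theorem polar_smul {c : ℂ} (hc : c ≠ 0) (y : Fin 2 → ℂ) : polar (c • y) = polar y := by
  have hc' : conj c ≠ 0 := by simpa using hc
  have h1 : sqNorm (c • y) = c * conj c * sqNorm y := by
    simp [sqNorm]; ring
  rw [polar, polar, h1, ← mul_div_mul_left _ (sqNorm y) (mul_ne_zero hc hc')]
  congr 1
  simp; ring

/-- The denominator of `recipForm` has real part `2 re lam`, because `p` is real. -/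
theorem form_denominator_re (lam : ℂ) (y : Fin 2 → ℂ) :
    (lam + conj lam + (lam - conj lam) * polar y).re = 2 * lam.re := by
  rw [← ofReal_re_polar y]
  simp; ring

theorem form_denominator_ne_zero (hre : 0 < lam.re) (y : Fin 2 → ℂ) :
    lam + conj lam + (lam - conj lam) * polar y ≠ 0 := by
  intro h
  have := form_denominator_re lam y
  rw [h] at this
  simp at this
  linarith

theorem d_self_eq (lam : ℂ) (hy : y ≠ 0) :
    d lam y y = sqNorm y * ((lam + conj lam + (lam - conj lam) * polar y) / 2) := by
  have hN := sqNorm_ne_zero hy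
  rw [polar, d]
  field_simp
  rw [sqNorm]; ring

theorem d_self_ne_zero (hre : 0 < lam.re) (hy : y ≠ 0) : d lam y y ≠ 0 := by
  rw [d_self_eq lam hy]
  exact mul_ne_zero (sqNorm_ne_zero hy)
    (div_ne_zero (form_denominator_ne_zero hre y) two_ne_zero)

theorem G_eq (hre : 0 < lam.re) (hy : y ≠ 0) :
    G lam y = (lam + conj lam) * recipForm lam y + -1 := by
  have hN := sqNorm_ne_zero hy
  have hD := form_denominator_ne_zero hre y
  rw [G, d_self_eq lam hy, d_self_eq (conj lam) hy, recipForm, Complex.conj_conj,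
    show conj lam + lam + (conj lam - lam) * polar y =
      2 * (lam + conj lam) - (lam + conj lam + (lam - conj lam) * polar y) by ring]
  generalize lam + conj lam + (lam - conj lam) * polar y = D at hD ⊢
  field_simp
  ring

theorem S_eq (hre : 0 < lam.re) (hy : y ≠ 0) :
    S lam y = 2 * Complex.I * (lam ^ 2 - conj lam ^ 2) * recipForm lam y * cross y := by
  have hN := sqNorm_ne_zero hy
  have hD := form_denominator_ne_zero hre y
  rw [S, d_self_eq lam hy, recipForm, cross]
  field_simp

theorem norm_recipForm_le (hre : 0 < lam.re) (y : Fin 2 → ℂ) :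
    ‖recipForm lam y‖ ≤ lam.re⁻¹ := by
  have h1 := Complex.re_le_norm (lam + conj lam + (lam - conj lam) * polar y)
  rw [form_denominator_re] at h1
  have h2 : 0 < ‖lam + conj lam + (lam - conj lam) * polar y‖ := by linarith
  rw [recipForm, norm_div, div_le_iff₀ h2]
  calc ‖(2:ℂ)‖ = lam.re⁻¹ * (2 * lam.re) := by simp; field_simp
    _ ≤ _ := by gcongr

end Algebra

section Evolution

variable {U : ℝ → ℂ} {lam : ℂ} {ψ : ℝ → Fin 2 → ℂ}

/-- The evolution of `p` and `q`, written as polynomials in `p`, `q`, `U` and conjugates, without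
subtraction, in the form in which the function classes are closed. -/
theorem hasDerivAt_polar_and_cross (hU : Continuous U) (h : IsKNSolution U lam ψ)
    (hψ : ∀ x, ψ x ≠ 0) (x : ℝ) :
    HasDerivAt (fun x => polar (ψ x))
      (-4 * Complex.I * (lam ^ 2 - conj lam ^ 2) * (cross (ψ x) * conj (cross (ψ x))) +
        ((lam + conj lam) * (U x * conj (cross (ψ x)) + conj (U x) * cross (ψ x)) +
        -(lam - conj lam) * (polar (ψ x) *
          (U x * conj (cross (ψ x)) + -1 * (conj (U x) * cross (ψ x)))))) x ∧
    HasDerivAt (fun x => cross (ψ x))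
      ((-Complex.I * (lam ^ 2 + conj lam ^ 2) +
          Complex.I * (lam ^ 2 - conj lam ^ 2) * polar (ψ x)) * cross (ψ x) +
        (((lam - conj lam) / 2 + -(lam + conj lam) / 2 * polar (ψ x)) * U x +
        -(lam - conj lam) * (cross (ψ x) *
          (U x * conj (cross (ψ x)) + -1 * (conj (U x) * cross (ψ x)))))) x := by
  have hN := sqNorm_ne_zero (hψ x)
  have h0 := hasDerivAt_zero_of_isKNSolution hU h x
  have h1 := hasDerivAt_one_of_isKNSolution hU h x
  have h0c := hasDerivAt_conj h0
  have h1c := hasDerivAt_conj h1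
  have hNd := (h0.mul h0c).add (h1.mul h1c)
  have hN' : ψ x 0 * conj (ψ x 0) + ψ x 1 * conj (ψ x 1) ≠ 0 := hN
  constructor
  · convert! ((h0.mul h0c).sub (h1.mul h1c)).div hNd hN' using 1
    rw [conj_cross, cross, polar, sqNorm]
    simp only [Pi.add_apply, Pi.sub_apply, Pi.mul_apply, map_add, map_sub, map_mul,
      map_neg, map_pow, Complex.conj_I, Complex.conj_conj]
    field_simp
    ring
  · convert! (h0.mul h1c).div hNd hN' using 1
    rw [conj_cross, cross, polar, sqNorm]
    simp only [Pi.add_apply, Pi.mul_apply, map_add, map_sub, map_mul, map_neg, map_pow,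
      Complex.conj_I, Complex.conj_conj]
    field_simp
    ring

end Evolution

/-! ### Regularity and decay of the transformed potential -/

section Regularity

variable {U : ℝ → ℂ} {lam : ℂ} {ψ : ℝ → Fin 2 → ℂ}

/-- `q ∈ L^{2,1}`: the equation `p' = 8 im(lam²) |q|² + O(|U| |q|)` with `4 |q|² = 1 - p²` makes `p`
increase up to an error controlled by `|U|²`. -/
theorem memL21_cross (hre : 0 < lam.re) (him : 0 < lam.im) (hU : IsDecay U)
    (h : IsKNSolution U lam ψ) (hψ : ∀ x, ψ x ≠ 0)
    (hlim : Tendsto (fun x => polar (ψ x)) atBot (𝓝 1)) : MemL21 fun x => cross (ψ x) := by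
  have hd := fun x => hasDerivAt_polar_and_cross hU.1.1 h hψ x
  have hpc := continuous_of_forall_hasDerivAt fun x => (hd x).1
  have hqc := continuous_of_forall_hasDerivAt fun x => (hd x).2
  have hUc := hU.1.1
  set κ : ℝ := 8 * (lam.re * lam.im) with hκ
  have hκ0 : 0 < κ := by positivity
  set C : ℝ := 2 * ‖lam + conj lam‖ + 2 * ‖lam - conj lam‖ with hC
  have hC0 : 0 ≤ C := by positivity
  rw [memL21_iff hqc]
  refine integrable_weight_of_tendsto_atBot (κ := κ)
    (fun x => Complex.reCLM.hasFDerivAt.comp_hasDerivAt x (hd x).1)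
    (r := fun x => C ^ 2 / (4 * κ) * ‖U x‖ ^ 2)
    ?_ (by fun_prop) (by fun_prop) (fun x => by positivity) (fun x => by positivity) hκ0
    (fun x => abs_re_polar_le (hψ x)) (fun x => four_mul_normSq_cross (hψ x)) (fun x => ?_) ?_ ?_
  · exact Complex.reCLM.continuous.comp (by fun_prop)
  · simp only [Complex.reCLM_apply]
    set p := polar (ψ x) with hp
    set q := cross (ψ x) with hq
    have hpn : ‖p‖ ≤ 1 := by
      rw [hp, ← ofReal_re_polar, Complex.norm_real]
      exact abs_re_polar_le (hψ x)
    set W := U x * conj q with hW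
    set V := conj (U x) * q with hV
    have hWn : ‖W‖ = ‖U x‖ * ‖q‖ := by simp [hW]
    have hVn : ‖V‖ = ‖U x‖ * ‖q‖ := by simp [hV]
    have hmain : -4 * Complex.I * (lam ^ 2 - conj lam ^ 2) * (q * conj q)
        = ((2 * κ * ‖q‖ ^ 2 : ℝ) : ℂ) := by
      rw [Complex.mul_conj, Complex.normSq_eq_norm_sq,
        show lam ^ 2 - conj lam ^ 2 = (lam + conj lam) * (lam - conj lam) by ring,
        Complex.add_conj, Complex.sub_conj, hκ]
      push_cast
      linear_combination (-16 * (lam.re : ℂ) * lam.im * ‖q‖ ^ 2) * Complex.I_sq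
    set R := (lam + conj lam) * (W + V) + -(lam - conj lam) * (p * (W + -1 * V)) with hR
    have hRn : ‖R‖ ≤ C * (‖U x‖ * ‖q‖) := by
      have h1 : ‖W + V‖ ≤ 2 * (‖U x‖ * ‖q‖) := by
        refine (norm_add_le _ _).trans ?_
        rw [hWn, hVn]; linarith
      have h2 : ‖W + -1 * V‖ ≤ 2 * (‖U x‖ * ‖q‖) := by
        refine (norm_add_le _ _).trans ?_
        rw [neg_one_mul, norm_neg, hWn, hVn]; linarith
      calc ‖R‖ ≤ ‖lam + conj lam‖ * ‖W + V‖ + ‖lam - conj lam‖ * (‖p‖ * ‖W + -1 * V‖) := by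
            refine (norm_add_le _ _).trans ?_
            rw [norm_mul, norm_mul, norm_mul, norm_neg]
        _ ≤ ‖lam + conj lam‖ * (2 * (‖U x‖ * ‖q‖)) +
            ‖lam - conj lam‖ * (1 * (2 * (‖U x‖ * ‖q‖))) := by gcongr
        _ = _ := by rw [hC]; ring
    rw [hmain, Complex.add_re, Complex.ofReal_re]
    have h1 := (abs_le.1 ((Complex.abs_re_le_norm R).trans hRn)).1
    -- Young's inequality absorbs half of `2 κ ‖q‖²`
    have h2 : 0 ≤ (C * ‖U x‖ - 2 * κ * ‖q‖) ^ 2 / (4 * κ) := by positivity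
    have h3 : (C * ‖U x‖ - 2 * κ * ‖q‖) ^ 2 / (4 * κ)
        = C ^ 2 / (4 * κ) * ‖U x‖ ^ 2 - C * (‖U x‖ * ‖q‖) + κ * ‖q‖ ^ 2 := by
      field_simp; ring
    linarith
  · refine (((memL21_iff hUc).1 hU.2).const_mul (C ^ 2 / (4 * κ))).congr
      (Eventually.of_forall fun x => ?_)
    ring
  · exact (Complex.continuous_re.tendsto _).comp hlim

theorem isBC_polar (hU : Continuous U) (h : IsKNSolution U lam ψ) (hψ : ∀ x, ψ x ≠ 0) :
    IsBC fun x => polar (ψ x) := by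
  refine ⟨continuous_of_forall_hasDerivAt fun x => (hasDerivAt_polar_and_cross hU h hψ x).1,
    1, fun x => ?_⟩
  change ‖polar (ψ x)‖ ≤ 1
  rw [← ofReal_re_polar, Complex.norm_real]
  exact abs_re_polar_le (hψ x)

theorem isBC_cross (hU : Continuous U) (h : IsKNSolution U lam ψ) (hψ : ∀ x, ψ x ≠ 0) :
    IsBC fun x => cross (ψ x) := by
  refine ⟨continuous_of_forall_hasDerivAt fun x => (hasDerivAt_polar_and_cross hU h hψ x).2,
    1, fun x => ?_⟩
  have := four_mul_normSq_cross (hψ x)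
  nlinarith [sq_nonneg (polar (ψ x)).re, norm_nonneg (cross (ψ x))]

/-- Bootstrap: `p`, `q` and `h` are bounded, hence so are their derivatives, which are polynomials
in them and `U`; differentiating these polynomials once more gives the second derivatives. Each term of
`q'` has a factor `q` or `U`, whence the decay. -/
theorem isDecay2_cross_and_isBC2_recipForm (hre : 0 < lam.re) (him : 0 < lam.im) (hU : IsDecay2 U)
    (h : IsKNSolution U lam ψ) (hψ : ∀ x, ψ x ≠ 0)
    (hlim : Tendsto (fun x => polar (ψ x)) atBot (𝓝 1)) :
    (IsDecay2 fun x => cross (ψ x)) ∧ IsBC2 fun x => recipForm lam (ψ x) := by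
  have hU1 := hU.isDecay1
  have hU0 := hU1.isDecay
  have hUc := hU0.1.1
  have hp0 := isBC_polar hUc h hψ
  have hq0 : IsDecay fun x => cross (ψ x) :=
    ⟨isBC_cross hUc h hψ, memL21_cross hre him hU0 h hψ hlim⟩
  have hd := fun x => hasDerivAt_polar_and_cross hUc h hψ x
  have hp1 : IsBC1 fun x => polar (ψ x) :=
    ⟨_, fun x => (hd x).1, hp0,
      ((isBC_const _).mul (hq0.1.mul hq0.1.conj)).add
        (((isBC_const _).mul ((hU0.1.mul hq0.1.conj).add (hU0.1.conj.mul hq0.1))).add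
        ((isBC_const _).mul (hp0.mul ((hU0.1.mul hq0.1.conj).add
          ((isBC_const _).mul (hU0.1.conj.mul hq0.1))))))⟩
  have hq1 : IsDecay1 fun x => cross (ψ x) :=
    ⟨_, fun x => (hd x).2, hq0,
      (((isBC_const _).add ((isBC_const _).mul hp0)).mul_isDecay hq0).add
        ((((isBC_const _).add ((isBC_const _).mul hp0)).mul_isDecay hU0).add
        ((isBC_const _).mul_isDecay (hq0.1.mul_isDecay ((hU0.1.mul_isDecay hq0.conj).add
          ((isBC_const _).mul_isDecay (hU0.1.conj.mul_isDecay hq0))))))⟩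
  have hUB := hU1.isBC1
  have hqB := hq1.isBC1
  refine ⟨isDecay2_of_hasDerivAt (fun x => (hd x).2) hq0
    ((((isBC1_const _).add ((isBC1_const _).mul hp1)).mul_isDecay1 hq1).add
        ((((isBC1_const _).add ((isBC1_const _).mul hp1)).mul_isDecay1 hU1).add
        ((isBC1_const _).mul_isDecay1 (hqB.mul_isDecay1 ((hUB.mul_isDecay1 hq1.conj).add
          ((isBC1_const _).mul_isDecay1 (hUB.conj.mul_isDecay1 hq1))))))), ?_⟩
  have hD1 := ((isBC1_const (-4 * Complex.I * (lam ^ 2 - conj lam ^ 2))).mul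
      (hqB.mul hqB.conj)).add
        (((isBC1_const (lam + conj lam)).mul ((hUB.mul hqB.conj).add (hUB.conj.mul hqB))).add
        ((isBC1_const (-(lam - conj lam))).mul (hp1.mul ((hUB.mul hqB.conj).add
          ((isBC1_const (-1)).mul (hUB.conj.mul hqB))))))
  have hden := fun x => form_denominator_ne_zero hre (ψ x)
  have hhd : ∀ x, HasDerivAt (fun x => recipForm lam (ψ x)) _ x := fun x =>
    (hasDerivAt_const x (2 : ℂ)).div (((hd x).1.const_mul (lam - conj lam)).const_add
      (lam + conj lam)) (hden x)
  have hh0 : IsBC fun x => recipForm lam (ψ x) :=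
    ⟨continuous_of_forall_hasDerivAt hhd, _, fun x => norm_recipForm_le hre (ψ x)⟩
  -- the derivative of `h` in polynomial form, `h' = -(lam - conj lam) / 2 * h² * p'`
  have hform : ∀ D p : ℂ, lam + conj lam + (lam - conj lam) * p ≠ 0 →
      (0 * (lam + conj lam + (lam - conj lam) * p) - 2 * ((lam - conj lam) * D)) /
        (lam + conj lam + (lam - conj lam) * p) ^ 2 =
      -(lam - conj lam) / 2 * (2 / (lam + conj lam + (lam - conj lam) * p) *
        (2 / (lam + conj lam + (lam - conj lam) * p)) * D) := by
    intro D p hD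
    field_simp
    ring
  have hhd' := fun x => (hhd x).congr_deriv (hform _ _ (hden x))
  have hh1 : IsBC1 fun x => recipForm lam (ψ x) := by
    refine ⟨_, hhd', hh0, ?_⟩
    obtain ⟨-, -, hD0, -⟩ := hD1
    exact (isBC_const _).mul ((hh0.mul hh0).mul hD0)
  exact ⟨_, hhd', hh0, (isBC1_const _).mul ((hh1.mul hh1).mul hD1)⟩

theorem isDecay2_backlund (hre : 0 < lam.re) (him : 0 < lam.im) (hU : IsDecay2 U)
    (h : IsKNSolution U lam ψ) (hψ : ∀ x, ψ x ≠ 0)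
    (hlim : Tendsto (fun x => polar (ψ x)) atBot (𝓝 1)) : IsDecay2 (backlund lam ψ U) := by
  obtain ⟨hq, hh⟩ := isDecay2_cross_and_isBC2_recipForm hre him hU h hψ hlim
  have hG := ((isBC2_const (lam + conj lam)).mul hh).add (isBC2_const (-1))
  have hB := hG.mul_isDecay2 ((((isBC2_const (-1)).mul hG).mul_isDecay2 hU).add
    (((isBC2_const (2 * Complex.I * (lam ^ 2 - conj lam ^ 2))).mul hh).mul_isDecay2 hq))
  convert! hB using 1
  funext x
  rw [backlund, G_eq hre (hψ x), S_eq hre (hψ x)]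
  ring

end Regularity

theorem IsJostMinus.tendsto_polar {U : ℝ → ℂ} {lam : ℂ} {φ : ℝ → Fin 2 → ℂ}
    (h : IsJostMinus U lam φ) :
    Tendsto (fun x => polar (expFactor lam x • φ x)) atBot (𝓝 1) := by
  simp only [fun x => polar_smul (expFactor_ne_zero lam x) (φ x)]
  have hc : ∀ {f : ℝ → ℂ} {z : ℂ}, Tendsto f atBot (𝓝 z) →
      Tendsto (fun x => conj (f x)) atBot (𝓝 (conj z)) := fun hf =>
    (Complex.continuous_conj.tendsto _).comp hf
  have h0 := h.tendsto_zero.mul (hc h.tendsto_zero)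
  have h1 := h.tendsto_one.mul (hc h.tendsto_one)
  have := (h0.sub h1).div (h0.add h1) (by simp)
  simp only [map_one, map_zero, mul_one, mul_zero, sub_zero, add_zero, div_one] at this
  exact this

/-! ### Inversion of the Bäcklund transformation -/

section Inverse

variable {lam : ℂ} {η : ℝ → Fin 2 → ℂ}

theorem d_conj (lam : ℂ) (y : Fin 2 → ℂ) : d (conj lam) y y = conj (d lam y y) := by
  simp [d]; ring

theorem G_ne_zero {y : Fin 2 → ℂ} (hd : d lam y y ≠ 0) : G lam y ≠ 0 := by
  rw [G, d_conj]
  exact div_ne_zero (by simpa using hd) hd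

theorem norm_G {y : Fin 2 → ℂ} (hd : d lam y y ≠ 0) : ‖G lam y‖ = 1 := by
  rw [G, d_conj, norm_div, RCLike.norm_conj, div_self (by simpa using hd)]

/-- When `G_lam(ξ) G_lam(η) = 1`, the composition of the two affine maps is a translation, by
`G_lam(ξ) (S_lam(ξ) - S_lam(η))`. -/
theorem leftInverse_backlund_iff {ξ : ℝ → Fin 2 → ℂ}
    (hG : ∀ x, G lam (ξ x) * G lam (η x) = 1) :
    Function.LeftInverse (backlund lam ξ) (backlund lam η) ↔
      ∀ x, S lam (ξ x) = S lam (η x) := by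
  have key : ∀ (v : ℝ → ℂ) (x : ℝ), backlund lam ξ (backlund lam η v) x
      = v x + G lam (ξ x) * (S lam (ξ x) - S lam (η x)) := by
    intro v x
    simp only [backlund]
    linear_combination (v x * (G lam (ξ x) * G lam (η x) + 1) - G lam (ξ x) * S lam (η x)) * hG x
  constructor
  · intro h x
    have h1 := congrFun (h 0) x
    rw [key] at h1
    have hG0 : G lam (ξ x) ≠ 0 := left_ne_zero_of_mul_eq_one (hG x)
    simpa [hG0, sub_eq_zero] using h1
  · intro h v
    funext x
    rw [key, h x]; ring

theorem d_etaStar {k₁ k₂ : ℝ → ℂ} {x : ℝ} (hk : ‖k₁ x‖ = ‖k₂ x‖) :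
    d lam (etaStar k₁ k₂ η x) (etaStar k₁ k₂ η x) =
      k₂ x * conj (k₂ x) * d (conj lam) (η x) (η x) := by
  have : k₁ x * conj (k₁ x) = k₂ x * conj (k₂ x) := by
    rw [Complex.mul_conj, Complex.mul_conj, Complex.normSq_eq_norm_sq, Complex.normSq_eq_norm_sq,
      hk]
  simp only [d, etaStar, Matrix.cons_val_zero, Matrix.cons_val_one, map_mul, Complex.conj_conj]
  linear_combination (lam * conj (η x 1) * η x 1) * this

theorem G_etaStar_mul {k₁ k₂ : ℝ → ℂ} {x : ℝ} (hk : ‖k₁ x‖ = ‖k₂ x‖) (hk0 : k₂ x ≠ 0)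
    (hd : d lam (η x) (η x) ≠ 0) : G lam (etaStar k₁ k₂ η x) * G lam (η x) = 1 := by
  have hk0' : conj (k₂ x) ≠ 0 := by simpa using hk0
  have hd' : d (conj lam) (η x) (η x) ≠ 0 := by rw [d_conj]; simpa using hd
  rw [G, G, d_etaStar (lam := lam) hk, d_etaStar (lam := conj lam) hk, Complex.conj_conj]
  field_simp

theorem S_etaStar_eq_iff {k₁ k₂ : ℝ → ℂ} {x : ℝ} (hlam : lam ^ 2 - conj lam ^ 2 ≠ 0)
    (hk : ‖k₁ x‖ = ‖k₂ x‖) (hk0 : k₂ x ≠ 0) (hd : d lam (η x) (η x) ≠ 0) :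
    S lam (etaStar k₁ k₂ η x) = S lam (η x) ↔
      (η x 0 * η x 1 ≠ 0 → k₁ x = G lam (η x) * k₂ x) := by
  have hk0' : conj (k₂ x) ≠ 0 := by simpa using hk0
  have hd' : d (conj lam) (η x) (η x) ≠ 0 := by rw [d_conj]; simpa using hd
  have hc : 2 * Complex.I * (lam ^ 2 - conj lam ^ 2) ≠ 0 := by simp [hlam]
  rw [S, S, mul_right_inj' hc, d_etaStar hk]
  simp only [etaStar, Matrix.cons_val_zero, Matrix.cons_val_one, map_mul, Complex.conj_conj]
  rw [div_eq_div_iff (mul_ne_zero (mul_ne_zero hk0 hk0') hd') hd]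
  have e : k₁ x * conj (η x 1) * (conj (k₂ x) * η x 0) * d lam (η x) (η x) -
      η x 0 * conj (η x 1) * (k₂ x * conj (k₂ x) * d (conj lam) (η x) (η x)) =
      (η x 0 * conj (η x 1)) * (conj (k₂ x) * d lam (η x) (η x)) *
        (k₁ x - G lam (η x) * k₂ x) := by
    rw [G]; field_simp
  rw [← sub_eq_zero, e, mul_eq_zero, sub_eq_zero, or_iff_not_imp_left]
  have h1 : η x 0 * conj (η x 1) * (conj (k₂ x) * d lam (η x) (η x)) = 0 ↔ η x 0 * η x 1 = 0 := by
    simp [hk0, hd]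
  rw [h1]

end Inverse

end KaupNewell

theorem mainTheorem2 (lam₁ : ℂ) (hre : 0 < lam₁.re) (him : 0 < lam₁.im)
    (u : ℝ → ℂ) (hu2 : KaupNewell.MemH2 u) (hu11 : KaupNewell.MemH11 u) :
    (∃! φ : ℝ → Fin 2 → ℂ, KaupNewell.IsJostMinus u lam₁ φ) ∧
    ∀ φ η : ℝ → Fin 2 → ℂ, KaupNewell.IsJostMinus u lam₁ φ →
      (η = fun x => KaupNewell.expFactor lam₁ x • φ x) →
      (∀ x, KaupNewell.d lam₁ (η x) (η x) ≠ 0) ∧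
      KaupNewell.MemH2 (KaupNewell.backlund lam₁ η u) ∧
      KaupNewell.MemH11 (KaupNewell.backlund lam₁ η u) ∧
      (∃ k₁ k₂ : ℝ → ℂ, Continuous k₁ ∧ Continuous k₂ ∧
        (∀ x, k₁ x ≠ 0 ∧ ‖k₁ x‖ = ‖k₂ x‖) ∧
        Function.LeftInverse
          (KaupNewell.backlund lam₁ (KaupNewell.etaStar k₁ k₂ η))
          (KaupNewell.backlund lam₁ η)) ∧
      (∀ k₁ k₂ : ℝ → ℂ, (∀ x, k₁ x ≠ 0 ∧ ‖k₁ x‖ = ‖k₂ x‖) →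
        (Function.LeftInverse
            (KaupNewell.backlund lam₁ (KaupNewell.etaStar k₁ k₂ η))
            (KaupNewell.backlund lam₁ η) ↔
          ∀ x, η x 0 * η x 1 ≠ 0 → k₁ x = KaupNewell.G lam₁ (η x) * k₂ x))
 := by
  obtain ⟨U, hae, hU⟩ := KaupNewell.exists_isDecay2_representative hu2 hu11
  have hU0 := hU.isDecay1.isDecay
  have hUc := hU0.1.1
  obtain ⟨B, hB⟩ := hU0.1.2
  have hUi := KaupNewell.integrable_of_memL21 hUc hU0.2
  have hlam : 0 < lam₁.re * lam₁.im := mul_pos hre him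
  have hsq : lam₁ ^ 2 - conj lam₁ ^ 2 ≠ 0 := by
    rw [show lam₁ ^ 2 - conj lam₁ ^ 2 = (lam₁ + conj lam₁) * (lam₁ - conj lam₁) by ring,
      Complex.add_conj, Complex.sub_conj]
    simp [hre.ne', him.ne']
  refine ⟨?_, ?_⟩
  · obtain ⟨φ, hφ⟩ := KaupNewell.exists_isJostMinus hUc hUi hlam
    exact ⟨φ, hφ.congr_ae hae.symm, fun φ' hφ' => (hφ'.congr_ae hae).unique hUc hB hlam hφ⟩
  rintro φ η hφu rfl
  have hφ := hφu.congr_ae hae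
  set η : ℝ → Fin 2 → ℂ := fun x => KaupNewell.expFactor lam₁ x • φ x with hη
  have hη0 : ∀ x, η x ≠ 0 := fun x =>
    smul_ne_zero (KaupNewell.expFactor_ne_zero lam₁ x) (hφ.ne_zero hUc hB x)
  have hd : ∀ x, KaupNewell.d lam₁ (η x) (η x) ≠ 0 := fun x =>
    KaupNewell.d_self_ne_zero hre (hη0 x)
  have hreg := KaupNewell.isDecay2_backlund hre him hU hφ.1 hη0 hφ.tendsto_polar
  have hbae : KaupNewell.backlund lam₁ η U =ᵐ[volume] KaupNewell.backlund lam₁ η u :=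
    hae.mono fun x hx => by simp only [KaupNewell.backlund, hx]
  obtain ⟨hH2, hH11⟩ := hreg.memH2_memH11 hbae
  have hiff : ∀ k₁ k₂ : ℝ → ℂ, (∀ x, k₁ x ≠ 0 ∧ ‖k₁ x‖ = ‖k₂ x‖) →
      (Function.LeftInverse
          (KaupNewell.backlund lam₁ (KaupNewell.etaStar k₁ k₂ η))
          (KaupNewell.backlund lam₁ η) ↔
        ∀ x, η x 0 * η x 1 ≠ 0 → k₁ x = KaupNewell.G lam₁ (η x) * k₂ x) := by
    intro k₁ k₂ hk
    have hk0 : ∀ x, k₂ x ≠ 0 := fun x => by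
      rw [← norm_ne_zero_iff, ← (hk x).2, norm_ne_zero_iff]; exact (hk x).1
    rw [KaupNewell.leftInverse_backlund_iff fun x =>
      KaupNewell.G_etaStar_mul (hk x).2 (hk0 x) (hd x)]
    exact forall_congr' fun x => KaupNewell.S_etaStar_eq_iff hsq (hk x).2 (hk0 x) (hd x)
  refine ⟨hd, hH2, hH11, ?_, hiff⟩
  have hk : ∀ x, KaupNewell.G lam₁ (η x) ≠ 0 ∧ ‖KaupNewell.G lam₁ (η x)‖ = ‖(1:ℂ)‖ := fun x =>
    ⟨KaupNewell.G_ne_zero (hd x), by rw [KaupNewell.norm_G (hd x), norm_one]⟩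
  refine ⟨fun x => KaupNewell.G lam₁ (η x), fun _ => 1, ?_, continuous_const, hk,
    (hiff _ _ hk).2 fun x _ => (mul_one _).symm⟩
  have hηc : Continuous η := hφ.1.1
  have h0 : Continuous fun x => η x 0 := (continuous_apply 0).comp hηc
  have h1 : Continuous fun x => η x 1 := (continuous_apply 1).comp hηc
  simp only [KaupNewell.G]
  refine Continuous.div ?_ ?_ hd <;>
  · simp only [KaupNewell.d]
    fun_prop
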